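/- An algebra $L$ over a field $K$ (not assumed associative, anticommutative, unital or finite-dimensional), with product denoted by $[\,,\,]$, is called a Lie type algebra if for all $a,b,c\in L$ there exist $\alpha,\beta\in K$ (possibly depending on $a,b,c$) such that $\alpha\neq 0$ and $$[[a,b],c]=\alpha\,[a,[b,c]]+\beta\,[[a,c],b].\qquad (*)$$ For a subalgebra $S$ put $\gamma_1(S)=S$ and let $\gamma_{k+1}(S)=[\gamma_k(S),S]$ be the span of all products $[x,y]$ with $x\in\gamma_k(S)$, $y\in S$; $S$ is nilpotent of class at most $c$ if $\gamma_{c+1}(S)=0$. For a group $G$ of ($K$-linear) automorphisms of $L$ let $C_L(G)=\{x\in L: x^{g}=x \text{ for all } g\in G\}$. Theorem. There is a function $f:\mathbb N\times\mathbb N\to\mathbb N$ with the following property. Let $L$ be a Lie type algebra, possibly of infinite dimension, over an arbitrary field $K$. Suppose that $L$ admits a finite Frobenius group of automorphisms $FH$ with cyclic kernel $F$ of order $n$ and complement $H$ of order $q$ (that is, $F$ and $H$ are nontrivial, $F$ is normal in $FH$, $F\cap H=1$, and no nontrivial element of $H$ commutes with a nontrivial element of $F$), such that $C_L(F)=0$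 and $C_L(H)$ is nilpotent of class at most $c$. Assume also that either $K$ contains a primitive $n$th root of unity, or $(*)$ holds for all $a,b,c\in L$ with constants $\alpha\ne 0$, $\beta$ in $K$ that do not depend on $a,b,c$. Then $L$ is nilpotent of class at most $f(q,c)$. -/

import Mathlib

/-- The `K`-algebra `L`, with product written `a * b` for `[a, b]`, is a Lie type algebra: for all
`a b c` there are scalars `α ≠ 0` and `β`, which may depend on `a b c`, such that
`[[a, b], c] = α [a, [b, c]] + β [[a, c], b]`. -/
def IsLieTypeAlgebra (K L : Type*) [Field K] [NonUnitalNonAssocRing L] [Module K L] : Prop :=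
  ∀ a b c : L, ∃ α β : K, α ≠ 0 ∧ (a * b) * c = α • (a * (b * c)) + β • ((a * c) * b)

/-- The scalars `α ≠ 0` and `β` in the Lie type identity can be chosen independently of the
elements `a b c`. -/
def HasConstantLieTypeIdentity (K L : Type*) [Field K] [NonUnitalNonAssocRing L] [Module K L] :
    Prop :=
  ∃ α β : K, α ≠ 0 ∧ ∀ a b c : L, (a * b) * c = α • (a * (b * c)) + β • ((a * c) * b)

/-- The group of automorphisms of the (not necessarily associative or unital) `K`-algebra `L`:
the `K`-linear bijections of `L` onto itself that preserve the product. -/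
def algebraAut (K L : Type*) [Field K] [NonUnitalNonAssocRing L] [Module K L] :
    Subgroup (L ≃ₗ[K] L) where
  carrier := {φ | ∀ x y : L, φ (x * y) = φ x * φ y}
  one_mem' := fun _ _ => rfl
  mul_mem' := by
    intro φ ψ hφ hψ x y
    simp only [Set.mem_ofPred_eq] at hφ hψ
    simp only [LinearEquiv.mul_apply, hψ, hφ]
  inv_mem' := by
    intro φ hφ x y
    simp only [Set.mem_ofPred_eq] at hφ
    apply φ.injective
    have h : ∀ z : L, φ (φ⁻¹ z) = z := fun z => φ.apply_symm_apply z
    rw [hφ, h, h, h]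

/-- The fixed-point subalgebra `C_L(G)` of a group `G` of automorphisms of `L`. -/
def fixedPointSubalgebra {K L : Type*} [Field K] [NonUnitalNonAssocRing L] [Module K L]
    (G : Subgroup (algebraAut K L)) : NonUnitalSubalgebra K L where
  carrier := {x | ∀ φ ∈ G, (φ : L ≃ₗ[K] L) x = x}
  zero_mem' := fun φ _ => map_zero (φ : L ≃ₗ[K] L)
  add_mem' := by
    intro x y hx hy φ hφ
    rw [map_add, hx φ hφ, hy φ hφ]
  smul_mem' := by
    intro k x hx φ hφ
    rw [map_smul, hx φ hφ]
  mul_mem' := by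
    intro x y hx hy φ hφ
    rw [φ.2 x y, hx φ hφ, hy φ hφ]

/-- The subgroups `F` and `H` of a group `G` generate a (finite) Frobenius group `FH` with kernel
`F` and complement `H`: `FH` is a semidirect product of the nontrivial subgroups `F`, which is
normal in `FH`, and `H`, and no nontrivial element of `H` commutes with a nontrivial element
of `F`. -/
structure IsFrobeniusGroup {G : Type*} [Group G] (F H : Subgroup G) : Prop where
  finite_kernel : Finite F
  finite_complement : Finite H
  kernel_ne_bot : F ≠ ⊥
  complement_ne_bot : H ≠ ⊥
  complement_normalizes : ∀ h ∈ H, ∀ f ∈ F, h * f * h⁻¹ ∈ F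
  inf_eq_bot : F ⊓ H = ⊥
  fixed_point_free : ∀ f ∈ F, ∀ h ∈ H, f ≠ 1 → h ≠ 1 → h * f ≠ f * h

/-- The lower central series of a subspace `S` of `L` (of use when `S` is a subalgebra):
`lowerCentral S k` is the term usually written `γ_{k+1}(S)`, where `γ_1(S) = S` and
`γ_{k+1}(S) = [γ_k(S), S]` is the subspace spanned by the products `[x, y]` with `x` in `γ_k(S)`
and `y` in `S`. -/
def lowerCentral {K L : Type*} [Field K] [NonUnitalNonAssocRing L] [Module K L]
    (S : Submodule K L) : ℕ → Submodule K L
  | 0 => S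
  | k + 1 => Submodule.span K {z | ∃ x ∈ lowerCentral S k, ∃ y ∈ S, x * y = z}

/-- The subalgebra `S` is nilpotent of class at most `c`, that is, `γ_{c+1}(S) = 0`. -/
def IsNilpotentOfClassLE {K L : Type*} [Field K] [NonUnitalNonAssocRing L] [Module K L]
    (S : NonUnitalSubalgebra K L) (c : ℕ) : Prop :=
  lowerCentral S.toSubmodule c = ⊥

/-! Suppose first that `K` contains a primitive `n`th root of unity. The eigenspaces `P i` of a
generator `φ` of `F` then grade `L` by `ZMod n`. Here `P 0 = 0` because `C_L(F) = 0`, and `h ∈ H`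
maps `P i` into `P (χ h * i)`, where `χ h - 1` is a unit for every `h ≠ 1`. The task is to bound
everything in terms of `q` and `c` alone, never `n`.

Nilpotency of `C_L(H)` enters through traces `tr x = ∑ h, ρ h x`, which are fixed by `H`. When `[tr
x₀, …, tr x_c] = 0` is expanded for homogeneous `xᵢ` whose degrees are independent (`IsIndep`), the
term `[x₀, …, x_c]` is alone in its degree, so it vanishes (`FixedNilpotent.wordSpan_eq_bot`). An
independent list fails to extend only by boundedly many degrees, its `resonances`.

Solvability (`exists_derivedFamily_iterate_le`) is by induction on `c` modulo an ideal. An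
independent word one factor shorter is killed by all but boundedly many components. A resultant
argument shows that constant lists of large additive order are independent, which bounds repetitions
of a letter. Hence the right ideal generated by the word lives in boundedly many degrees, and
Kreknin's theorem, in the form whose bound depends on the number of nonzero components only, shows
that a bounded derived term annihilates it.

Nilpotency then climbs back up the derived series (`lowerCentral_eq_bot_of_prodSpan`): if `[N, N]`
is nilpotent, then so is `N`. Modulo products with `[N, N]` letters commute, so a long word either
contains enough independent letters or repeats one letter many times. In the second case a component
is recovered from `φ`-translates of its traces, and pigeonhole produces `c` equal translates.

Only two inclusions between products of subspaces are drawn from the Lie type identity, so its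
coefficients may vary. When they are constant, the identity survives extension of scalars. This
supplies the root of unity, after the part of `φ` of order a power of the characteristic is removed.
-/

set_option linter.unusedSectionVars false

/-! ### Products of subspaces and the Lie type identity -/

section SubmoduleProduct

variable {K L : Type*} [Field K] [NonUnitalNonAssocRing L] [Module K L]

/-- The product `[A, B]` of two subspaces: the span of all products of their elements. -/
def prodSpan (A B : Submodule K L) : Submodule K L :=
  Submodule.span K {z | ∃ x ∈ A, ∃ y ∈ B, x * y = z}

local infixl:70 " ⋄ " => prodSpan

theorem prodSpan_le {A B C : Submodule K L} : A ⋄ B ≤ C ↔ ∀ x ∈ A, ∀ y ∈ B, x * y ∈ C := by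
  rw [prodSpan, Submodule.span_le]
  constructor
  · exact fun h x hx y hy => h ⟨x, hx, y, hy, rfl⟩
  · rintro h _ ⟨x, hx, y, hy, rfl⟩
    exact h x hx y hy

theorem mul_mem_prodSpan {A B : Submodule K L} {x y : L} (hx : x ∈ A) (hy : y ∈ B) :
    x * y ∈ A ⋄ B :=
  Submodule.subset_span ⟨x, hx, y, hy, rfl⟩

theorem prodSpan_mono {A A' B B' : Submodule K L} (hA : A ≤ A') (hB : B ≤ B') :
    A ⋄ B ≤ A' ⋄ B' :=
  prodSpan_le.2 fun _ hx _ hy => mul_mem_prodSpan (hA hx) (hB hy)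

variable [IsScalarTower K L L] [SMulCommClass K L L]

theorem prodSpan_eq_map₂ (A B : Submodule K L) :
    A ⋄ B = Submodule.map₂ (LinearMap.mul K L) A B := by
  rw [Submodule.map₂_eq_span_image2]
  rfl

theorem sup_prodSpan (A B C : Submodule K L) : (A ⊔ B) ⋄ C = A ⋄ C ⊔ B ⋄ C := by
  simp only [prodSpan_eq_map₂, Submodule.map₂_sup_left]

theorem prodSpan_sup (A B C : Submodule K L) : A ⋄ (B ⊔ C) = A ⋄ B ⊔ A ⋄ C := by
  simp only [prodSpan_eq_map₂, Submodule.map₂_sup_right]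

theorem iSup_prodSpan {ι : Sort*} (A : ι → Submodule K L) (C : Submodule K L) :
    (⨆ i, A i) ⋄ C = ⨆ i, A i ⋄ C := by
  simp only [prodSpan_eq_map₂, Submodule.map₂_iSup_left]

theorem prodSpan_iSup {ι : Sort*} (C : Submodule K L) (A : ι → Submodule K L) :
    C ⋄ (⨆ i, A i) = ⨆ i, C ⋄ A i := by
  simp only [prodSpan_eq_map₂, Submodule.map₂_iSup_right]

/-- The elements `x` such that `x B ⊆ C`. -/
def leftTransporter (B C : Submodule K L) : Submodule K L where
  carrier := {x | ∀ y ∈ B, x * y ∈ C}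
  zero_mem' := fun y _ => by simp
  add_mem' := fun ha hb y hy => by
    rw [add_mul]; exact C.add_mem (ha y hy) (hb y hy)
  smul_mem' := fun k x hx y hy => by
    rw [smul_mul_assoc]; exact C.smul_mem k (hx y hy)

/-- The elements `y` such that `A y ⊆ C`. -/
def rightTransporter (A C : Submodule K L) : Submodule K L where
  carrier := {y | ∀ x ∈ A, x * y ∈ C}
  zero_mem' := fun y _ => by simp
  add_mem' := fun ha hb y hy => by
    rw [mul_add]; exact C.add_mem (ha y hy) (hb y hy)
  smul_mem' := fun k x hx y hy => by
    rw [mul_smul_comm]; exact C.smul_mem k (hx y hy)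

theorem le_leftTransporter {A B C : Submodule K L} : A ≤ leftTransporter B C ↔ A ⋄ B ≤ C :=
  prodSpan_le.symm

theorem le_rightTransporter {A B C : Submodule K L} : B ≤ rightTransporter A C ↔ A ⋄ B ≤ C :=
  ⟨fun h => prodSpan_le.2 fun x hx _ hy => h hy x hx, fun h _ hy _ hx =>
    h (mul_mem_prodSpan hx hy)⟩

/-- At the level of subspaces the dependence of `α` and `β` on the elements disappears. This
inclusion and the next, which inverts `α`, carry all later rearrangements of products. -/
theorem IsLieTypeAlgebra.prodSpan_prodSpan_right (hL : IsLieTypeAlgebra K L)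
    (A B C : Submodule K L) : (A ⋄ B) ⋄ C ≤ A ⋄ (B ⋄ C) ⊔ (A ⋄ C) ⋄ B := by
  rw [← le_leftTransporter, prodSpan_le]
  intro a ha b hb c hc
  obtain ⟨α, β, -, h⟩ := hL a b c
  rw [h]
  exact Submodule.add_mem_sup
    (Submodule.smul_mem _ _ (mul_mem_prodSpan ha (mul_mem_prodSpan hb hc)))
    (Submodule.smul_mem _ _ (mul_mem_prodSpan (mul_mem_prodSpan ha hc) hb))

theorem IsLieTypeAlgebra.prodSpan_prodSpan_left (hL : IsLieTypeAlgebra K L)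
    (A B C : Submodule K L) : A ⋄ (B ⋄ C) ≤ (A ⋄ B) ⋄ C ⊔ (A ⋄ C) ⋄ B := by
  rw [← le_rightTransporter, prodSpan_le]
  intro b hb c hc a ha
  obtain ⟨α, β, hα, h⟩ := hL a b c
  have : a * (b * c) = α⁻¹ • ((a * b) * c) - (α⁻¹ * β) • ((a * c) * b) := by
    rw [h, smul_add, smul_smul, smul_smul, inv_mul_cancel₀ hα, one_smul, add_sub_cancel_right]
  rw [this]
  exact Submodule.sub_mem _
    (Submodule.mem_sup_left
      (Submodule.smul_mem _ _ (mul_mem_prodSpan (mul_mem_prodSpan ha hb) hc)))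
    (Submodule.mem_sup_right
      (Submodule.smul_mem _ _ (mul_mem_prodSpan (mul_mem_prodSpan ha hc) hb)))

end SubmoduleProduct

/-! ### Kreknin's theorem modulo an ideal, with few nontrivial components -/

section Kreknin

variable {K L : Type*} [Field K] [NonUnitalNonAssocRing L] [Module K L]

local infixl:70 " ⋄ " => prodSpan

/-- A subspace of `L` that is a two-sided ideal. -/
def IsIdealOf (C : Submodule K L) : Prop := ∀ x ∈ C, ∀ y : L, x * y ∈ C ∧ y * x ∈ C

theorem IsIdealOf.prodSpan_right_le {C : Submodule K L} (hC : IsIdealOf C) {A B : Submodule K L}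
    (h : A ≤ C) : A ⋄ B ≤ C :=
  prodSpan_le.2 fun x hx y _ => (hC x (h hx) y).1

theorem IsIdealOf.prodSpan_left_le {C : Submodule K L} (hC : IsIdealOf C) {A B : Submodule K L}
    (h : B ≤ C) : A ⋄ B ≤ C :=
  prodSpan_le.2 fun x _ y hy => (hC y (h hy) x).2

/-- The homogeneous components of `[P, P]` for a graded subspace `P`. -/
def derivedFamily {A : Type*} [AddCommGroup A] (P : A → Submodule K L) : A → Submodule K L :=
  fun k => ⨆ i, P i ⋄ P (k - i)

theorem derivedFamily_le {A : Type*} [AddCommGroup A] {P Q : A → Submodule K L} :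
    derivedFamily P ≤ Q ↔ ∀ i j, P i ⋄ P j ≤ Q (i + j) := by
  constructor
  · intro h i j
    refine le_trans ?_ (h (i + j))
    refine le_trans ?_ (le_iSup _ i)
    simp
  · intro h k
    refine iSup_le fun i => ?_
    have := h i (k - i)
    rwa [add_sub_cancel] at this

theorem derivedFamily_mono {A : Type*} [AddCommGroup A] {P Q : A → Submodule K L} (h : P ≤ Q) :
    derivedFamily P ≤ derivedFamily Q :=
  fun _ => iSup_mono fun _ => prodSpan_mono (h _) (h _)

theorem derivedFamily_iterate_mono {A : Type*} [AddCommGroup A] {P Q : A → Submodule K L}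
    (h : P ≤ Q) (s : ℕ) : derivedFamily^[s] P ≤ derivedFamily^[s] Q :=
  Monotone.iterate (fun _ _ h => derivedFamily_mono h) s h

theorem derivedFamily_iterate_le {A : Type*} [AddCommGroup A] {P : A → Submodule K L}
    (h : derivedFamily P ≤ P) (s : ℕ) : derivedFamily^[s] P ≤ P := by
  induction s with
  | zero => exact le_rfl
  | succ s ih =>
    rw [Function.iterate_succ_apply']
    exact (derivedFamily_mono ih).trans h

theorem derivedFamily_iterate_le_of_le {A : Type*} [AddCommGroup A] {P : A → Submodule K L}
    (h : derivedFamily P ≤ P) {s t : ℕ} (hst : s ≤ t) :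
    derivedFamily^[t] P ≤ derivedFamily^[s] P := by
  obtain ⟨u, rfl⟩ := Nat.exists_eq_add_of_le hst
  rw [Function.iterate_add_apply]
  exact derivedFamily_iterate_mono (derivedFamily_iterate_le h u) s

variable {n : ℕ}

/-- `Q` contains `C` and the components `P m` with `k < m`, and is stable under right
multiplication by the latter. -/
def UpperClosed (C : Submodule K L) (P : ZMod n → Submodule K L) (k : ℕ)
    (Q : ZMod n → Submodule K L) : Prop :=
  (∀ i, C ≤ Q i) ∧ (∀ m, k < m.val → P m ≤ Q m) ∧ ∀ i m, k < m.val → Q i ⋄ P m ≤ Q (i + m)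

/-- The graded subspace generated by `C` and the components `P m` with `k < m` under right
multiplication by the latter. -/
def upperSpan (C : Submodule K L) (P : ZMod n → Submodule K L) (k : ℕ) :
    ZMod n → Submodule K L :=
  sInf {Q | UpperClosed C P k Q}

theorem upperSpan_le {C : Submodule K L} {P : ZMod n → Submodule K L} {k : ℕ}
    {Q : ZMod n → Submodule K L} (h : UpperClosed C P k Q) : upperSpan C P k ≤ Q :=
  sInf_le h

theorem upperClosed_upperSpan (C : Submodule K L) (P : ZMod n → Submodule K L) (k : ℕ) :
    UpperClosed C P k (upperSpan C P k) := by
  have key : ∀ (i : ZMod n) (X : Submodule K L),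
      (∀ Q, UpperClosed C P k Q → X ≤ Q i) → X ≤ upperSpan C P k i := by
    intro i X hX
    rw [upperSpan, sInf_apply]
    exact le_iInf fun Q => hX Q.1 Q.2
  refine ⟨fun i => key _ _ fun Q hQ => hQ.1 i, fun m hm => key _ _ fun Q hQ => hQ.2.1 m hm,
    fun i m hm => key _ _ fun Q hQ => ?_⟩
  exact (prodSpan_mono (upperSpan_le hQ i) le_rfl).trans (hQ.2.2 i m hm)

variable [IsScalarTower K L L] [SMulCommClass K L L]

/-- A graded subspace that is stable under right multiplication by generators is stable under
right multiplication by the graded subspace generated by them. -/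
theorem prodSpan_upperSpan_le (hL : IsLieTypeAlgebra K L) {C : Submodule K L}
    (hC : IsIdealOf C) {P T : ZMod n → Submodule K L} {k : ℕ} (hCT : ∀ i, C ≤ T i)
    (hT : ∀ i m, k < m.val → T i ⋄ P m ≤ T (i + m)) (i j : ZMod n) :
    T i ⋄ upperSpan C P k j ≤ T (i + j) := by
  have hcl : UpperClosed C P k (fun j => ⨅ i, rightTransporter (T i) (T (i + j))) := by
    refine ⟨fun j => le_iInf fun i => ?_, fun m hm => le_iInf fun i => ?_, fun j m hm =>
      le_iInf fun i => ?_⟩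
    · rw [le_rightTransporter]
      exact (hC.prodSpan_left_le le_rfl).trans (hCT _)
    · rw [le_rightTransporter]
      exact hT i m hm
    · rw [le_rightTransporter]
      have h : ∀ i, T i ⋄ (⨅ i, rightTransporter (T i) (T (i + j))) ≤ T (i + j) := fun i =>
        le_rightTransporter.1 (iInf_le _ i)
      refine (hL.prodSpan_prodSpan_left _ _ _).trans (sup_le ?_ ?_)
      · refine (prodSpan_mono (h i) le_rfl).trans ((hT _ _ hm).trans ?_)
        rw [add_assoc]
      · refine (prodSpan_mono (hT _ _ hm) le_rfl).trans ((h _).trans ?_)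
        rw [add_assoc, add_comm m j]
  have := upperSpan_le hcl j
  exact le_rightTransporter.1 (this.trans (iInf_le _ i))

theorem derivedFamily_upperSpan_le (hL : IsLieTypeAlgebra K L) {C : Submodule K L}
    (hC : IsIdealOf C) (P : ZMod n → Submodule K L) (k : ℕ) (i j : ZMod n) :
    upperSpan C P k i ⋄ upperSpan C P k j ≤ upperSpan C P k (i + j) :=
  prodSpan_upperSpan_le hL hC (upperClosed_upperSpan C P k).1
    (upperClosed_upperSpan C P k).2.2 i j

/-- The sum of representatives must wrap around, so `i.val = k.val + (n - j.val)`. -/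
theorem val_lt_of_add_eq [NeZero n] {i j k : ZMod n} (h : i + j = k) (hj : k.val < j.val) :
    k.val < i.val := by
  have h1 := ZMod.val_add i j
  rw [h] at h1
  by_contra hi
  have hi' : i.val ≤ k.val := not_lt.1 hi
  have hjn := ZMod.val_lt j
  have hin := ZMod.val_lt i
  rcases lt_or_ge (i.val + j.val) n with hlt | hge
  · rw [Nat.mod_eq_of_lt hlt] at h1
    omega
  · rw [Nat.mod_eq_sub_mod hge, Nat.mod_eq_of_lt (by omega)] at h1
    omega

/-- The elimination step of Kreknin's argument: products landing in degree `κ = k + 1` can be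
rewritten without the generator `P κ` itself. -/
theorem prodSpan_le_upperSpan [NeZero n] (hL : IsLieTypeAlgebra K L) {C : Submodule K L}
    (hC : IsIdealOf C) {P : ZMod n → Submodule K L} (hP : derivedFamily P ≤ P) (h0 : P 0 ≤ C)
    {k : ℕ} {κ : ZMod n} (hκ : κ.val = k + 1) {i j : ZMod n} (hi : i ≠ κ) (hij : i + j = κ) :
    P i ⋄ upperSpan C P k j ≤ upperSpan C P (k + 1) κ := by
  have hPP := derivedFamily_le.1 hP
  have hU := upperClosed_upperSpan C P (k + 1)
  -- Only degree `κ` is shrunk. Stability of `T` under `P m` with `k < m.val` is then at stake only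
  -- for `i + m = κ`: if `m = κ`, then `i = 0` and the product is in `C`; otherwise wrap-around puts
  -- both `i` and `m` above `k + 1`.
  let T : ZMod n → Submodule K L := fun i =>
    if i = κ then upperSpan C P (k + 1) κ else P i ⊔ C
  have hκ0 : κ ≠ 0 := by
    rintro rfl
    simp at hκ
  have hCT : ∀ i, C ≤ T i := by
    intro i
    by_cases h : i = κ
    · simpa [T, h] using hU.1 κ
    · simp [T, h]
  have hPT : ∀ i, i ≠ κ → P i ≤ T i := fun i h => by simp [T, h]
  have hPCT : ∀ i m, i + m ≠ κ → (P i ⊔ C) ⋄ P m ≤ T (i + m) := fun i m h => by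
    rw [sup_prodSpan]
    exact sup_le ((hPP i m).trans (hPT _ h)) ((hC.prodSpan_right_le le_rfl).trans (hCT _))
  have hTP : T ≤ fun i => P i ⊔ C := by
    intro i
    by_cases h : i = κ
    · simp only [T, h, if_true]
      refine upperSpan_le (Q := fun i => P i ⊔ C) ⟨fun i => le_sup_right, fun m _ =>
        le_sup_left, fun i m _ => ?_⟩ κ
      rw [sup_prodSpan]
      exact sup_le ((hPP i m).trans le_sup_left) ((hC.prodSpan_right_le le_rfl).trans le_sup_right)
    · simp [T, h]
  have hT : ∀ i m, k < m.val → T i ⋄ P m ≤ T (i + m) := by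
    intro i m hm
    by_cases h : i + m = κ
    · have hTκ : T (i + m) = upperSpan C P (k + 1) κ := by simp [T, h]
      rw [hTκ]
      refine (prodSpan_mono (hTP i) le_rfl).trans ?_
      rw [sup_prodSpan]
      refine sup_le ?_ ((hC.prodSpan_right_le le_rfl).trans (hU.1 κ))
      by_cases hmκ : m = κ
      · have : i = 0 := by rw [hmκ] at h; simpa using h
        rw [this]
        exact (hC.prodSpan_right_le h0).trans (hU.1 κ)
      · have hm' : k + 1 < m.val := by
          have : m.val ≠ κ.val := fun e => hmκ (ZMod.val_injective n e)
          omega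
        have hi' : k + 1 < i.val := by
          have := val_lt_of_add_eq h (by omega)
          omega
        rw [← h]
        exact (prodSpan_mono (hU.2.1 i hi') le_rfl).trans (hU.2.2 i m hm')
    · exact (prodSpan_mono (hTP i) le_rfl).trans (hPCT i m h)
  have := prodSpan_upperSpan_le hL hC hCT hT i j
  rw [hij] at this
  refine (prodSpan_mono (hPT i hi) le_rfl).trans (this.trans ?_)
  simp [T]

/-- Generators are eliminated in increasing order of degree. A degree outside `S` costs nothing,
since its component is already in `C`; a degree in `S` takes the number `s` of derived steps to `2 *
s + 1`, hence the exponent `2 ^ r - 1`. -/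
theorem derivedFamily_iterate_le_upperSpan [NeZero n] (hL : IsLieTypeAlgebra K L)
    {C : Submodule K L} (hC : IsIdealOf C) (S : Finset (ZMod n)) (k : ℕ) (hk : k < n) :
    ∀ P : ZMod n → Submodule K L, derivedFamily P ≤ P → P 0 ≤ C → (∀ i ∉ S, P i ≤ C) →
      derivedFamily^[2 ^ (S.filter fun i => 0 < i.val ∧ i.val ≤ k).card - 1] P
        ≤ upperSpan C P k := by
  induction k with
  | zero =>
    intro P hP h0 _
    have : (S.filter fun i : ZMod n => 0 < i.val ∧ i.val ≤ 0) = ∅ := by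
      ext i
      simp
    rw [this]
    intro i
    have hU := upperClosed_upperSpan C P 0
    by_cases hi : i = 0
    · subst hi
      exact h0.trans (hU.1 0)
    · exact hU.2.1 i (Nat.pos_of_ne_zero fun e => hi ((ZMod.val_eq_zero i).1 e))
  | succ k ih =>
    intro P hP h0 hS
    have ih := ih (by omega)
    have hU := upperClosed_upperSpan C P (k + 1)
    have hPP := derivedFamily_le.1 hP
    set κ : ZMod n := ((k + 1 : ℕ) : ZMod n) with hκdef
    have hκ : κ.val = k + 1 := ZMod.val_cast_of_lt hk
    have hκm : ∀ m : ZMod n, k < m.val → m ≠ κ → k + 1 < m.val := by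
      intro m hm hne
      have : m.val ≠ κ.val := fun e => hne (ZMod.val_injective n e)
      omega
    by_cases hκS : κ ∈ S
    · have hfil : (S.filter fun i : ZMod n => 0 < i.val ∧ i.val ≤ k + 1)
          = insert κ (S.filter fun i : ZMod n => 0 < i.val ∧ i.val ≤ k) := by
        ext i
        simp only [Finset.mem_filter, Finset.mem_insert]
        constructor
        · rintro ⟨h1, h2, h3⟩
          by_cases h : i = κ
          · exact Or.inl h
          · right
            have : i.val ≠ κ.val := fun e => h (ZMod.val_injective n e)
            exact ⟨h1, h2, by omega⟩
        · rintro (rfl | ⟨h1, h2, h3⟩)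
          · exact ⟨hκS, by omega, by omega⟩
          · exact ⟨h1, h2, by omega⟩
      rw [hfil, Finset.card_insert_of_notMem (by simp [hκ])]
      set s := 2 ^ (S.filter fun i : ZMod n => 0 < i.val ∧ i.val ≤ k).card - 1 with hs
      have hs' : 2 ^ ((S.filter fun i : ZMod n => 0 < i.val ∧ i.val ≤ k).card + 1) - 1
          = s + (s + 1) := by
        have : 0 < 2 ^ (S.filter fun i : ZMod n => 0 < i.val ∧ i.val ≤ k).card := by positivity
        rw [pow_succ]
        omega
      rw [hs', Function.iterate_add_apply]
      set Z := derivedFamily^[s] P with hZ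
      have hZA : Z ≤ upperSpan C P k := ih P hP h0 hS
      have hZP : Z ≤ P := derivedFamily_iterate_le hP s
      have hYeq : derivedFamily^[s + 1] P = derivedFamily Z := by
        rw [Function.iterate_succ_apply']
      rw [hYeq]
      set Y := derivedFamily Z with hY
      have hYP : Y ≤ P := (derivedFamily_mono hZP).trans hP
      -- One further derived step writes degree `κ` as products to which the elimination lemma
      -- applies. The remaining `s` steps rerun the induction hypothesis on `Y`, whose generator in
      -- degree `κ` is now redundant.
      have hYκ : Y κ ≤ upperSpan C P (k + 1) κ := by
        refine iSup_le fun i => ?_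
        by_cases hi : i = κ
        · rw [hi, sub_self]
          exact (hC.prodSpan_left_le ((hZP 0).trans h0)).trans (hU.1 _)
        · exact (prodSpan_mono (hZP i) (hZA _)).trans
            (prodSpan_le_upperSpan hL hC hP h0 hκ hi (by abel))
      have hYclosed : derivedFamily Y ≤ Y := by
        refine derivedFamily_mono ?_
        have : derivedFamily Z ≤ Z := by
          rw [← hY, ← hYeq]
          exact derivedFamily_iterate_le_of_le hP (Nat.le_succ s)
        exact this
      refine (ih Y hYclosed ((hYP 0).trans h0) fun i hi => (hYP i).trans (hS i hi)).trans ?_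
      refine upperSpan_le ⟨hU.1, fun m hm => ?_, fun i m hm => ?_⟩
      · by_cases h : m = κ
        · rw [h]; exact hYκ
        · exact (hYP m).trans (hU.2.1 m (hκm m hm h))
      · refine (prodSpan_mono le_rfl ?_).trans
          (derivedFamily_upperSpan_le hL hC P (k + 1) i m)
        by_cases h : m = κ
        · rw [h]; exact hYκ
        · exact (hYP m).trans (hU.2.1 m (hκm m hm h))
    · have hfil : (S.filter fun i : ZMod n => 0 < i.val ∧ i.val ≤ k + 1)
          = (S.filter fun i : ZMod n => 0 < i.val ∧ i.val ≤ k) := by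
        ext i
        simp only [Finset.mem_filter]
        constructor
        · rintro ⟨h1, h2, h3⟩
          have : i.val ≠ κ.val := fun e => hκS (ZMod.val_injective n e ▸ h1)
          exact ⟨h1, h2, by omega⟩
        · rintro ⟨h1, h2, h3⟩
          exact ⟨h1, h2, by omega⟩
      rw [hfil]
      refine (ih P hP h0 hS).trans (upperSpan_le ⟨hU.1, fun m hm => ?_, fun i m hm => ?_⟩)
      · by_cases h : m = κ
        · rw [h]; exact (hS κ hκS).trans (hU.1 κ)
        · exact hU.2.1 m (hκm m hm h)
      · by_cases h : m = κ
        · rw [h]; exact (hC.prodSpan_left_le (hS κ hκS)).trans (hU.1 _)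
        · exact hU.2.2 i m (hκm m hm h)

/-- Kreknin's theorem modulo an ideal `C`, in Shalev's form for few nontrivial components. -/
theorem derivedFamily_iterate_le_ideal [NeZero n] (hL : IsLieTypeAlgebra K L)
    {C : Submodule K L} (hC : IsIdealOf C) {P : ZMod n → Submodule K L}
    (hP : derivedFamily P ≤ P) (h0 : P 0 ≤ C) (S : Finset (ZMod n)) (hS : ∀ i ∉ S, P i ≤ C)
    (i : ZMod n) : derivedFamily^[2 ^ S.card] P i ≤ C := by
  have hn : 0 < n := Nat.pos_of_ne_zero (NeZero.ne n)
  have h := derivedFamily_iterate_le_upperSpan hL hC S (n - 1) (by omega) P hP h0 hS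
  have hle : 2 ^ (S.filter fun i : ZMod n => 0 < i.val ∧ i.val ≤ n - 1).card - 1 ≤ 2 ^ S.card :=
    (Nat.sub_le _ _).trans (Nat.pow_le_pow_right (by norm_num) (Finset.card_filter_le _ _))
  -- At level `n - 1` no generators are left except `C`.
  refine (derivedFamily_iterate_le_of_le hP hle i).trans ((h i).trans ?_)
  refine upperSpan_le (Q := fun _ => C) ⟨fun _ => le_rfl, fun m hm => ?_, fun i m hm => ?_⟩ i
  · have := ZMod.val_lt m
    omega
  · have := ZMod.val_lt m
    omega

end Kreknin

/-! ### Sums of roots of unity modulo `M` -/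

section CyclotomicBound

open Polynomial

/-- Roots of unity with a given primitive root `ζ` that average to `1` are all equal to `1`. -/
theorem all_eq_zero_of_sum_one_sub_pow_eq_zero {q : ℕ} {ζ : ℂ} (hζ : IsPrimitiveRoot ζ q)
    (hq : 0 < q) (s : Multiset (Fin q)) (h : (s.map fun e : Fin q => 1 - ζ ^ (e : ℕ)).sum = 0) :
    ∀ e ∈ s, (e : ℕ) = 0 := by
  have hnorm : ∀ e : ℕ, ‖ζ ^ e‖ = 1 := fun e => by
    rw [norm_pow, hζ.norm'_eq_one hq.ne', one_pow]
  have hnn : ∀ e : ℕ, 0 ≤ (1 - ζ ^ e).re := fun e => by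
    have := Complex.re_le_norm (ζ ^ e)
    rw [hnorm] at this
    simpa using this
  -- Every real part is nonnegative, so a zero sum makes each of them zero, which on the unit circle
  -- forces `ζ ^ e = 1`.
  have hre : (s.map fun e : Fin q => (1 - ζ ^ (e : ℕ)).re).sum = 0 := by
    have := congrArg Complex.reAddGroupHom h
    rw [map_multiset_sum, Multiset.map_map] at this
    simpa using this
  intro e he
  have h0 : (1 - ζ ^ (e : ℕ)).re = 0 := by
    have hle := Multiset.single_le_sum (s := s.map fun e : Fin q => (1 - ζ ^ (e : ℕ)).re)
      (by
        intro x hx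
        obtain ⟨e, -, rfl⟩ := Multiset.mem_map.1 hx
        exact hnn e) _ (Multiset.mem_map_of_mem _ he)
    rw [hre] at hle
    exact le_antisymm hle (hnn e)
  have h1 : (ζ ^ (e : ℕ)).re = 1 := by
    have : 1 - (ζ ^ (e : ℕ)).re = 0 := by simpa using h0
    linarith
  have h2 : ζ ^ (e : ℕ) = 1 := by
    have h3 := Complex.sq_norm (ζ ^ (e : ℕ))
    rw [hnorm, Complex.normSq_apply, h1] at h3
    have h4 : (ζ ^ (e : ℕ)).im = 0 := by nlinarith
    exact Complex.ext (by simpa using h1) (by simpa using h4)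
  exact Nat.eq_zero_of_dvd_of_lt (hζ.dvd_of_pow_eq_one _ h2) e.2

/-- The cyclotomic polynomial is irreducible over `ℚ`, and by the previous lemma it does not divide
the sum; so the two are coprime. Their resultant is the nonzero integer `N`. -/
theorem exists_cyclotomic_bezout {q : ℕ} (hq : 0 < q) (s : Multiset (Fin q))
    (hs : ∃ e ∈ s, (e : ℕ) ≠ 0) :
    ∃ (N : ℤ) (A B : ℤ[X]), N ≠ 0 ∧
      cyclotomic q ℤ * A + (s.map fun e : Fin q => 1 - X ^ (e : ℕ)).sum * B = C N := by
  set P : ℤ[X] := (s.map fun e : Fin q => 1 - X ^ (e : ℕ)).sum with hP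
  have hcop : IsCoprime ((cyclotomic q ℤ).map (Int.castRingHom ℚ)) (P.map (Int.castRingHom ℚ)) := by
    rw [map_cyclotomic_int]
    refine (cyclotomic.irreducible_rat hq).coprime_iff_not_dvd.2 fun hdvd => ?_
    have hζ := Complex.isPrimitiveRoot_exp q hq.ne'
    have hroot : aeval (Complex.exp (2 * Real.pi * Complex.I / q)) (cyclotomic q ℚ) = 0 := by
      rw [aeval_def, eval₂_eq_eval_map, map_cyclotomic]
      exact hζ.isRoot_cyclotomic hq
    have h0 := aeval_eq_zero_of_dvd_aeval_eq_zero hdvd hroot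
    obtain ⟨e, he, hne⟩ := hs
    refine hne (all_eq_zero_of_sum_one_sub_pow_eq_zero hζ hq s ?_ e he)
    have hmap : P.map (Int.castRingHom ℚ) = (s.map fun e : Fin q => 1 - X ^ (e : ℕ)).sum := by
      rw [hP, ← coe_mapRingHom, map_multiset_sum, Multiset.map_map]
      simp [Function.comp_def]
    rw [hmap, map_multiset_sum, Multiset.map_map] at h0
    simpa [Function.comp_def] using h0
  have hne : resultant (cyclotomic q ℤ) P ≠ 0 := by
    have := resultant_ne_zero _ _ hcop
    rw [natDegree_map_eq_of_injective (Int.castRingHom ℚ).injective_int,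
      natDegree_map_eq_of_injective (Int.castRingHom ℚ).injective_int, resultant_map_map] at this
    exact fun h => this (by rw [h, map_zero])
  obtain ⟨A, B, -, -, h⟩ := exists_mul_add_mul_eq_C_resultant (cyclotomic q ℤ) P le_rfl le_rfl
    (Or.inl (by rw [natDegree_cyclotomic]; exact (Nat.totient_pos.2 hq).ne'))
  exact ⟨_, A, B, hne, h⟩

/-- In the factorisation of `r ^ q - 1 = 0` the factors for proper divisors `d` of `q` divide the
units `r ^ d - 1`, so the remaining factor is zero. No domain hypothesis is needed. -/
theorem aeval_cyclotomic_eq_zero {R : Type*} [CommRing R] {q : ℕ} (hq : 0 < q) {r : R}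
    (hr : r ^ q = 1) (hu : ∀ d, 0 < d → d < q → IsUnit (r ^ d - 1)) :
    aeval r (cyclotomic q ℤ) = 0 := by
  have hprod : ∀ m : ℕ, 0 < m → ∏ i ∈ m.divisors, aeval r (cyclotomic i ℤ) = r ^ m - 1 := by
    intro m hm
    rw [← map_prod, prod_cyclotomic_eq_X_pow_sub_one hm]
    simp
  have h := hprod q hq
  rw [hr, sub_self, ← Nat.insert_self_properDivisors hq.ne',
    Finset.prod_insert Nat.self_notMem_properDivisors] at h
  have hunit : IsUnit (∏ i ∈ q.properDivisors, aeval r (cyclotomic i ℤ)) := by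
    rw [IsUnit.prod_iff]
    intro d hd
    obtain ⟨hdq, hlt⟩ := Nat.mem_properDivisors.1 hd
    have hd0 : 0 < d := Nat.pos_of_dvd_of_pos hdq hq
    refine isUnit_of_dvd_unit ?_ (hu d hd0 hlt)
    rw [← hprod d hd0]
    exact Finset.dvd_prod_of_mem _ (Nat.mem_divisors_self d hd0.ne')
  exact (hunit.mul_left_eq_zero).1 h

/-- A bound for the moduli `M` such that a sum of `c` powers of an element of order `q` modulo `M`,
not all equal to `1`, may be equal to `c`. -/
theorem exists_modulus_bound (q c : ℕ) (hq : 0 < q) :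
    ∃ N₀ : ℕ, 0 < N₀ ∧ ∀ (M : ℕ) (r : ZMod M), r ^ q = 1 →
      (∀ d, 0 < d → d < q → IsUnit (r ^ d - 1)) → N₀ < M →
      ∀ s : Multiset (Fin q), s.card = c → (s.map fun e : Fin q => 1 - r ^ (e : ℕ)).sum = 0 →
        ∀ e ∈ s, (e : ℕ) = 0 := by
  classical
  choose N A B hN hAB using fun s hs => exists_cyclotomic_bezout hq s hs
  -- There are finitely many multisets of size `c`, so their constants have a maximum. A nontrivial
  -- solution modulo `M` makes `M` divide the nonzero constant of its multiset.
  let g : Sym (Fin q) c → ℕ := fun s =>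
    if h : ∃ e ∈ (s : Multiset (Fin q)), (e : ℕ) ≠ 0 then (N s h).natAbs else 0
  refine ⟨Finset.univ.sup g + 1, Nat.succ_pos _, fun M r hr hu hM s hs hsum => ?_⟩
  by_contra! hne
  have h := congrArg (aeval r) (hAB s hne)
  rw [map_add, map_mul, map_mul, aeval_cyclotomic_eq_zero hq hr hu, map_multiset_sum,
    Multiset.map_map] at h
  have hsum' : (s.map ((aeval r) ∘ fun e : Fin q => (1 - X ^ (e : ℕ) : ℤ[X]))).sum = 0 := by
    simpa [Function.comp_def] using hsum
  rw [hsum', zero_mul, zero_mul, add_zero, aeval_C] at h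
  have hdvd : (M : ℤ) ∣ N s hne := by
    rw [← ZMod.intCast_zmod_eq_zero_iff_dvd]
    simpa using h.symm
  have h1 : M ≤ (N s hne).natAbs :=
    Nat.le_of_dvd (Int.natAbs_pos.2 (hN s hne)) (Int.natCast_dvd.1 hdvd)
  let s' : Sym (Fin q) c := ⟨s, hs⟩
  have h2 : g s' ≤ Finset.univ.sup g := Finset.le_sup (Finset.mem_univ s')
  have h3 : g s' = (N s hne).natAbs := dif_pos hne
  omega

end CyclotomicBound

/-! ### Independent lists of degrees and their resonances -/

section Independence

variable {n : ℕ} {H : Type*} [Group H]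

/-- The sum of the elements of a multiset of `ZMod n`, each twisted by an element of `H`. -/
def twistSum (χ : H →* (ZMod n)ˣ) (m : Multiset (H × ZMod n)) : ZMod n :=
  (m.map fun p => (χ p.1 : ZMod n) * p.2).sum

/-- A multiset of residues is independent if its sum is not equal to any other sum obtained by
replacing its members by members of their `H`-orbits. -/
def IsIndep (χ : H →* (ZMod n)ˣ) (s : Multiset (ZMod n)) : Prop :=
  ∀ m : Multiset (H × ZMod n), m.map Prod.snd = s → twistSum χ m = s.sum → ∀ p ∈ m, p.1 = 1

/-- The nontrivial elements of `H` act on `ZMod n` without nontrivial fixed points. -/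
def IsFixedPointFree (χ : H →* (ZMod n)ˣ) : Prop :=
  ∀ h, h ≠ 1 → IsUnit ((χ h : ZMod n) - 1)

theorem IsFixedPointFree.eq_one_or {χ : H →* (ZMod n)ˣ} (hχ : IsFixedPointFree χ) {h : H}
    {a : ZMod n} (ha : (χ h : ZMod n) * a = a) (ha0 : a ≠ 0) : h = 1 := by
  by_contra hne
  refine ha0 ((hχ h hne).mul_right_eq_zero.1 ?_)
  rw [sub_mul, ha, one_mul, sub_self]

theorem isIndep_singleton {χ : H →* (ZMod n)ˣ} (hχ : IsFixedPointFree χ) {a : ZMod n}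
    (ha : a ≠ 0) : IsIndep χ {a} := by
  intro m hm hsum p hp
  obtain ⟨p', rfl, hp'⟩ := Multiset.map_eq_singleton.1 hm
  rw [Multiset.mem_singleton] at hp
  subst hp
  simp only [twistSum, Multiset.map_singleton, Multiset.sum_singleton, hp'] at hsum
  exact hχ.eq_one_or hsum ha

variable [Fintype H]

/-- All sums of the elements of a list, each twisted by an element of `H`. -/
def orbitSums (χ : H →* (ZMod n)ˣ) : List (ZMod n) → Finset (ZMod n)
  | [] => {0}
  | a :: l => Finset.image₂ (fun h t => (χ h : ZMod n) * a + t) Finset.univ (orbitSums χ l)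

theorem card_orbitSums_le (χ : H →* (ZMod n)ˣ) (l : List (ZMod n)) :
    (orbitSums χ l).card ≤ Fintype.card H ^ l.length := by
  induction l with
  | nil => simp [orbitSums]
  | cons a l ih =>
    refine Finset.card_image₂_le _ _ _ |>.trans ?_
    rw [List.length_cons, pow_succ, mul_comm, Finset.card_univ]
    exact Nat.mul_le_mul_right _ ih

theorem twistSum_mem_orbitSums (χ : H →* (ZMod n)ˣ) (l : List (ZMod n)) :
    ∀ m : Multiset (H × ZMod n), m.map Prod.snd = l → twistSum χ m ∈ orbitSums χ l := by
  classical
  induction l with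
  | nil =>
    intro m hm
    have : m = 0 := by simpa using hm
    subst this
    simp [orbitSums, twistSum]
  | cons a l ih =>
    intro m hm
    rw [← Multiset.cons_coe, ← Multiset.map_eq_cons] at hm
    obtain ⟨p, hp, hpa, hm⟩ := hm
    rw [← Multiset.cons_erase hp]
    have : twistSum χ (p ::ₘ m.erase p) = (χ p.1 : ZMod n) * a + twistSum χ (m.erase p) := by
      simp [twistSum, hpa]
    rw [this]
    exact Finset.mem_image₂_of_mem (Finset.mem_univ _) (ih _ hm)

theorem sum_mem_orbitSums (χ : H →* (ZMod n)ˣ) (l : List (ZMod n)) : l.sum ∈ orbitSums χ l := by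
  induction l with
  | nil => simp [orbitSums]
  | cons a l ih =>
    rw [orbitSums, Finset.mem_image₂]
    exact ⟨1, Finset.mem_univ _, l.sum, ih, by simp⟩

/-- The residues `a` that may satisfy `h a + t = a + s` for a nontrivial `h` in `H` and
`H`-twisted sums `s` and `t` of the elements of `l`. -/
def resonances (χ : H →* (ZMod n)ˣ) (l : List (ZMod n)) : Finset (ZMod n) :=
  (Finset.univ ×ˢ orbitSums χ l ×ˢ orbitSums χ l).image
    fun p => (1 - (χ p.1 : ZMod n))⁻¹ * (p.2.1 - p.2.2)

theorem card_resonances_le (χ : H →* (ZMod n)ˣ) (l : List (ZMod n)) :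
    (resonances χ l).card ≤ Fintype.card H ^ (2 * l.length + 1) := by
  refine Finset.card_image_le.trans ?_
  rw [Finset.card_product, Finset.card_product, Finset.card_univ, pow_succ, two_mul, pow_add,
    mul_comm]
  exact Nat.mul_le_mul_right _ (Nat.mul_le_mul (card_orbitSums_le χ l) (card_orbitSums_le χ l))

theorem mem_resonances {χ : H →* (ZMod n)ˣ} (hχ : IsFixedPointFree χ) {l : List (ZMod n)}
    {h : H} (hh : h ≠ 1) {a t s : ZMod n} (ht : t ∈ orbitSums χ l) (hs : s ∈ orbitSums χ l)
    (e : (χ h : ZMod n) * a + t = a + s) : a ∈ resonances χ l := by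
  refine Finset.mem_image.2 ⟨(h, t, s), by simp [ht, hs], ?_⟩
  have hu : IsUnit (1 - (χ h : ZMod n)) := by
    rw [← neg_sub]
    exact (hχ h hh).neg
  have : t - s = (1 - (χ h : ZMod n)) * a := by linear_combination e
  simp only [this]
  rw [← mul_assoc, ZMod.inv_mul_of_unit _ hu, one_mul]

/-- In a nontrivial relation, `a` itself must be twisted, since otherwise it cancels and contradicts
the independence of `l`. The relation can then be solved for `a`, as `1 - χ h` is a unit. -/
theorem mem_resonances_of_not_isIndep {χ : H →* (ZMod n)ˣ} (hχ : IsFixedPointFree χ)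
    {l : List (ZMod n)} (hl : IsIndep χ l) {a : ZMod n} (ha : ¬ IsIndep χ (a ::ₘ (l : Multiset _))) :
    a ∈ resonances χ l := by
  classical
  simp only [IsIndep, not_forall] at ha
  obtain ⟨m, hm, hsum, p, hp, hp1⟩ := ha
  obtain ⟨p', hp', hpa, hm'⟩ := (Multiset.map_eq_cons ..).2 hm
  have htw : twistSum χ m = (χ p'.1 : ZMod n) * a + twistSum χ (m.erase p') := by
    conv_lhs => rw [← Multiset.cons_erase hp']
    simp [twistSum, hpa]
  rw [htw, Multiset.sum_cons] at hsum
  have hne : p'.1 ≠ 1 := by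
    intro h1
    rw [h1] at hsum
    simp only [map_one, Units.val_one, one_mul, add_right_inj] at hsum
    have := hl _ hm' hsum
    rw [← Multiset.cons_erase hp'] at hp
    rcases Multiset.mem_cons.1 hp with rfl | hp
    · exact hp1 h1
    · exact hp1 (this p hp)
  exact mem_resonances hχ hne (twistSum_mem_orbitSums χ l _ hm') (sum_mem_orbitSums χ l)
    (by simpa using hsum)

theorem isIndep_cons {χ : H →* (ZMod n)ˣ} (hχ : IsFixedPointFree χ)
    {l : List (ZMod n)} (hl : IsIndep χ l) {a : ZMod n} (ha : a ∉ resonances χ l) :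
    IsIndep χ (a ::ₘ (l : Multiset _)) :=
  not_not.1 fun h => ha (mem_resonances_of_not_isIndep hχ hl h)

/-- Constant sequences are independent if the order of the entry is large. -/
theorem exists_isIndep_replicate (q c : ℕ) (hq : 0 < q) :
    ∃ N₀ : ℕ, 0 < N₀ ∧ ∀ (n : ℕ) [NeZero n] (H : Type*) [Group H] [Fintype H]
      (χ : H →* (ZMod n)ˣ), Fintype.card H = q → IsFixedPointFree χ →
      ∀ d : ZMod n, N₀ < addOrderOf d → IsIndep χ (List.replicate c d : Multiset _) := by
  obtain ⟨N₀, hN₀, hbound⟩ := exists_modulus_bound q c hq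
  refine ⟨N₀, hN₀, fun n _ H _ _ χ hH hχ d hd m hm hsum => ?_⟩
  set M := addOrderOf d with hMdef
  have hMn : M ∣ n := by
    rw [addOrderOf_dvd_iff_nsmul_eq_zero]
    simp
  -- A relation among copies of `d` says that a coefficient annihilates `d`, that is, vanishes
  -- modulo the additive order `M` of `d`.
  let f : ZMod n →+* ZMod M := ZMod.castHom hMn (ZMod M)
  have hf : ∀ x : ZMod n, x * d = 0 → f x = 0 := by
    intro x hx
    have hx' : x.val • d = 0 := by
      rw [nsmul_eq_mul, ZMod.natCast_zmod_val, hx]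
    have hdvd := addOrderOf_dvd_iff_nsmul_eq_zero.2 hx'
    rw [← ZMod.natCast_zmod_val x, map_natCast, ZMod.natCast_eq_zero_iff]
    exact hdvd
  -- Modulo a prime divisor of `M` the character stays faithful, and a finite group of units of a
  -- field is cyclic. So all twists become powers of a single residue `r`.
  have hcyc : IsCyclic H := by
    obtain ⟨p, hp, hpM⟩ := Nat.exists_prime_and_dvd (show M ≠ 1 by omega)
    have : Fact p.Prime := ⟨hp⟩
    let g : ZMod n →+* ZMod p := ZMod.castHom (hpM.trans hMn) (ZMod p)
    let ψ : H →* ZMod p := (g : ZMod n →* ZMod p).comp ((Units.coeHom _).comp χ)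
    refine isCyclic_of_injective_ringHom ψ ((injective_iff_map_eq_one ψ).2 fun h hh => ?_)
    by_contra hne
    have hu := (hχ h hne).map g
    have : g ((χ h : ZMod n) - 1) = 0 := by
      rw [map_sub, map_one, sub_eq_zero]
      exact hh
    rw [this] at hu
    exact not_isUnit_zero hu
  obtain ⟨g, hg⟩ := hcyc.exists_generator
  have hgq : orderOf g = q := by rw [orderOf_eq_card_of_forall_mem_zpowers hg, Nat.card_eq_fintype_card, hH]
  set r : ZMod M := f (χ g) with hr
  have hrpow : ∀ e : ℕ, r ^ e = f (χ (g ^ e)) := fun e => by simp [hr]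
  have hrq : r ^ q = 1 := by
    rw [hrpow, ← hgq, pow_orderOf_eq_one]
    simp
  have hu : ∀ e, 0 < e → e < q → IsUnit (r ^ e - 1) := by
    intro e he heq
    have hne : g ^ e ≠ 1 := pow_ne_one_of_lt_orderOf he.ne' (hgq ▸ heq)
    have := (hχ _ hne).map f
    rwa [map_sub, map_one, ← hrpow] at this
  have hexp : ∀ h : H, ∃ e : Fin q, g ^ (e : ℕ) = h := by
    intro h
    classical
    obtain ⟨e, he, rfl⟩ := Finset.mem_image.1 (mem_zpowers_iff_mem_range_orderOf.1 (hg h))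
    exact ⟨⟨e, hgq ▸ Finset.mem_range.1 he⟩, rfl⟩
  choose ex hex using hexp
  have hsnd : ∀ p ∈ m, p.2 = d := by
    intro p hp
    have := Multiset.mem_map_of_mem Prod.snd hp
    rw [hm] at this
    exact List.eq_of_mem_replicate this
  have hcard : m.card = c := by
    rw [← Multiset.card_map Prod.snd, hm]
    simp
  have hzero : (m.map fun p => 1 - (χ p.1 : ZMod n)).sum * d = 0 := by
    have h1 : (m.map fun p => (1 - (χ p.1 : ZMod n)) * d)
        = m.map fun p => p.2 - (χ p.1 : ZMod n) * p.2 := by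
      refine Multiset.map_congr rfl fun p hp => ?_
      rw [hsnd p hp]
      ring
    rw [← Multiset.sum_map_mul_right, h1, Multiset.sum_map_sub, hm]
    exact sub_eq_zero.2 hsum.symm
  have hsum' := hf _ hzero
  rw [map_multiset_sum, Multiset.map_map] at hsum'
  have hfin := hbound M r hrq hu hd (m.map fun p => ex p.1) (by simpa using hcard) (by
    rw [Multiset.map_map, ← hsum']
    refine congrArg _ (Multiset.map_congr rfl fun p _ => ?_)
    simp only [Function.comp_apply, map_sub, map_one]
    rw [hrpow, hex])
  intro p hp
  have := hfin _ (Multiset.mem_map_of_mem _ hp)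
  rw [← hex p.1, this, pow_zero]

end Independence

/-! ### Left-normed words in graded components and the ideals they generate -/

section Words

variable {K L : Type*} [Field K] [NonUnitalNonAssocRing L] [Module K L]
  {A : Type*}

local infixl:70 " ⋄ " => prodSpan

/-- The left-normed product `[W, P i₁, …, P iₖ]` for a list of indices `i₁, …, iₖ`. -/
def wordSpan (P : A → Submodule K L) (W : Submodule K L) (l : List A) : Submodule K L :=
  l.foldl (fun V i => V ⋄ P i) W

@[simp] theorem wordSpan_nil (P : A → Submodule K L) (W : Submodule K L) :
    wordSpan P W [] = W := rfl

@[simp] theorem wordSpan_cons (P : A → Submodule K L) (W : Submodule K L) (i : A) (l : List A) :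
    wordSpan P W (i :: l) = wordSpan P (W ⋄ P i) l := rfl

theorem wordSpan_append (P : A → Submodule K L) (W : Submodule K L) (l l' : List A) :
    wordSpan P W (l ++ l') = wordSpan P (wordSpan P W l) l' :=
  List.foldl_append

theorem wordSpan_concat (P : A → Submodule K L) (W : Submodule K L) (l : List A) (i : A) :
    wordSpan P W (l ++ [i]) = wordSpan P W l ⋄ P i := by
  rw [wordSpan_append]
  rfl

theorem wordSpan_mono (P : A → Submodule K L) {W W' : Submodule K L} (h : W ≤ W') (l : List A) :
    wordSpan P W l ≤ wordSpan P W' l := by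
  induction l generalizing W W' with
  | nil => exact h
  | cons i l ih => exact ih (prodSpan_mono h le_rfl)

theorem wordSpan_congr {P Q : A → Submodule K L} (W : Submodule K L) {l : List A}
    (h : ∀ i ∈ l, P i = Q i) : wordSpan P W l = wordSpan Q W l := by
  induction l generalizing W with
  | nil => rfl
  | cons i l ih =>
    rw [wordSpan_cons, wordSpan_cons, h i List.mem_cons_self,
      ih _ fun j hj => h j (List.mem_cons_of_mem _ hj)]

theorem wordSpan_le_of_stable {P : A → Submodule K L} {C W : Submodule K L}
    (hC : ∀ i, C ⋄ P i ≤ C) (h : W ≤ C) (l : List A) : wordSpan P W l ≤ C := by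
  induction l generalizing W with
  | nil => exact h
  | cons i l ih => exact ih ((prodSpan_mono h le_rfl).trans (hC i))

variable [IsScalarTower K L L] [SMulCommClass K L L]

theorem wordSpan_sup (P : A → Submodule K L) (W W' : Submodule K L) (l : List A) :
    wordSpan P (W ⊔ W') l = wordSpan P W l ⊔ wordSpan P W' l := by
  induction l generalizing W W' with
  | nil => rfl
  | cons i l ih => simp only [wordSpan_cons, sup_prodSpan, ih]

variable [AddCommGroup A]

theorem wordSpan_le_component {P : A → Submodule K L} (hP : ∀ i j, P i ⋄ P j ≤ P (i + j))
    {W : Submodule K L} {b : A} (h : W ≤ P b) (l : List A) : wordSpan P W l ≤ P (b + l.sum) := by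
  induction l generalizing W b with
  | nil => simpa using h
  | cons i l ih =>
    rw [List.sum_cons, ← add_assoc]
    exact ih ((prodSpan_mono h le_rfl).trans (hP b i))

theorem wordSpan_swap_le (hL : IsLieTypeAlgebra K L) {P : A → Submodule K L}
    (hP : ∀ i j, P i ⋄ P j ≤ P (i + j)) (W : Submodule K L) (i j : A) (l : List A) :
    wordSpan P W (i :: j :: l) ≤ wordSpan P W ((i + j) :: l) ⊔ wordSpan P W (j :: i :: l) := by
  simp only [wordSpan_cons]
  rw [← wordSpan_sup]
  refine wordSpan_mono P ?_ l
  refine (hL.prodSpan_prodSpan_right _ _ _).trans (sup_le_sup ?_ le_rfl)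
  exact prodSpan_mono le_rfl (hP i j)

/-- Permuting the letters of a word does not matter modulo `C` if all shorter words of the same
degree are in `C`. -/
theorem wordSpan_le_of_perm (hL : IsLieTypeAlgebra K L) {P : A → Submodule K L}
    (hP : ∀ i j, P i ⋄ P j ≤ P (i + j)) {W C : Submodule K L} {N : ℕ} {e : A}
    (hshort : ∀ l : List A, l.length < N → l.sum = e → wordSpan P W l ≤ C) {l l' : List A}
    (hp : l.Perm l') :
    ∀ pre : List A, (pre ++ l).length = N → (pre ++ l).sum = e → wordSpan P W (pre ++ l') ≤ C →
      wordSpan P W (pre ++ l) ≤ C := by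
  induction hp with
  | nil => exact fun _ _ _ h => h
  | cons a _ ih =>
    intro pre hlen hsum h
    have := ih (pre ++ [a]) (by simpa using hlen) (by simpa using hsum) (by simpa using h)
    simpa using this
  | swap a b l =>
    intro pre hlen hsum h
    rw [wordSpan_append]
    refine (wordSpan_swap_le hL hP _ _ _ _).trans (sup_le ?_ ?_)
    · rw [← wordSpan_append]
      refine hshort _ ?_ ?_
      · simp at hlen ⊢
        omega
      · rw [← hsum]
        simp [add_assoc]
    · rw [← wordSpan_append]
      exact h
  | @trans l₁ l₂ l₃ h12 _ ih1 ih2 =>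
    intro pre hlen hsum h
    refine ih1 pre hlen hsum (ih2 pre ?_ ?_ h)
    · rw [← hlen, List.length_append, List.length_append, h12.length_eq]
    · rw [← hsum, List.sum_append, List.sum_append, h12.sum_eq]

/-- A product `[W, [P a, P i₁, …, P iₖ]]` is contained in the span of the left-normed products
of `W` and a permutation of the other factors. -/
theorem prodSpan_wordSpan_le (hL : IsLieTypeAlgebra K L) {P : A → Submodule K L}
    {C : Submodule K L} (a : A) (l : List A) :
    ∀ W : Submodule K L, (∀ l' : List A, l'.Perm (a :: l) → wordSpan P W l' ≤ C) →
      W ⋄ wordSpan P (P a) l ≤ C := by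
  suffices h : ∀ W : Submodule K L, W ⋄ wordSpan P (P a) l ≤
      ⨆ l' : {l' : List A // l'.Perm (a :: l)}, wordSpan P W l'.1 from
    fun W hW => (h W).trans (iSup_le fun l' => hW l'.1 l'.2)
  induction l using List.reverseRecOn with
  | nil => exact fun W => le_iSup_of_le ⟨[a], List.Perm.refl _⟩ le_rfl
  | append_singleton l x ih =>
    intro W
    rw [wordSpan_concat]
    refine (hL.prodSpan_prodSpan_left _ _ _).trans (sup_le ?_ ?_)
    · refine (prodSpan_mono (ih W) le_rfl).trans ?_
      rw [iSup_prodSpan]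
      refine iSup_le fun l' => ?_
      rw [← wordSpan_concat]
      exact le_iSup_of_le ⟨l'.1 ++ [x], by simpa using l'.2.append_right [x]⟩ le_rfl
    · refine (ih _).trans (iSup_le fun l' => ?_)
      rw [← wordSpan_cons]
      exact le_iSup_of_le ⟨x :: l'.1, by
        refine (l'.2.cons x).trans ?_
        have := (List.perm_append_comm (l₁ := [x]) (l₂ := a :: l))
        simpa using this⟩ le_rfl

theorem isIdealOf_of_iSup_eq_top {P : A → Submodule K L} (htop : ⨆ i, P i = ⊤)
    {C : Submodule K L} (hr : ∀ i, C ⋄ P i ≤ C) (hl : ∀ i, P i ⋄ C ≤ C) : IsIdealOf C := by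
  have h1 : C ⋄ ⊤ ≤ C := by
    rw [← htop, prodSpan_iSup]
    exact iSup_le hr
  have h2 : ⊤ ⋄ C ≤ C := by
    rw [← htop, iSup_prodSpan]
    exact iSup_le hl
  exact fun x hx y => ⟨prodSpan_le.1 h1 x hx y trivial, prodSpan_le.1 h2 y trivial x hx⟩

/-- The subspace generated by `W` under right multiplication by the components `P i`. -/
def rightClosure (P : A → Submodule K L) (W : Submodule K L) : Submodule K L :=
  ⨆ l : List A, wordSpan P W l

theorem wordSpan_le_rightClosure (P : A → Submodule K L) (W : Submodule K L) (l : List A) :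
    wordSpan P W l ≤ rightClosure P W :=
  le_iSup (wordSpan P W) l

theorem rightClosure_prodSpan_le (P : A → Submodule K L) (W : Submodule K L) (i : A) :
    rightClosure P W ⋄ P i ≤ rightClosure P W := by
  rw [rightClosure, iSup_prodSpan]
  refine iSup_le fun l => ?_
  rw [← wordSpan_concat]
  exact wordSpan_le_rightClosure P W _

/-- A left factor is absorbed by induction on the word: the identity splits off the last letter on
the right, where `I` is stable. So left multiples need checking on `W` only. -/
theorem prodSpan_rightClosure_le (hL : IsLieTypeAlgebra K L) {P : A → Submodule K L}
    (hP : ∀ i j, P i ⋄ P j ≤ P (i + j)) {W I : Submodule K L} (hI : ∀ i, I ⋄ P i ≤ I)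
    (hW : ∀ j, P j ⋄ W ≤ I) (i : A) : P i ⋄ rightClosure P W ≤ I := by
  rw [rightClosure, prodSpan_iSup]
  refine iSup_le fun l => ?_
  induction l using List.reverseRecOn generalizing i with
  | nil => exact hW i
  | append_singleton l x ih =>
    rw [wordSpan_concat]
    refine (hL.prodSpan_prodSpan_left _ _ _).trans (sup_le ?_ ?_)
    · exact (prodSpan_mono (ih i) le_rfl).trans (hI x)
    · exact (prodSpan_mono (hP i x) le_rfl).trans (ih _)

/-- The annihilator modulo `C` of a right ideal is two-sided, so Kreknin's theorem can be applied
modulo it. -/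
theorem isIdealOf_rightTransporter_rightClosure (hL : IsLieTypeAlgebra K L)
    {P : A → Submodule K L} (htop : ⨆ i, P i = ⊤) {C : Submodule K L} (hC : IsIdealOf C)
    (W : Submodule K L) : IsIdealOf (rightTransporter (rightClosure P W) C) := by
  have h : rightClosure P W ⋄ rightTransporter (rightClosure P W) C ≤ C :=
    le_rightTransporter.1 le_rfl
  refine isIdealOf_of_iSup_eq_top htop (fun i => ?_) (fun i => ?_)
  · rw [le_rightTransporter]
    refine (hL.prodSpan_prodSpan_left _ _ _).trans (sup_le ?_ ?_)
    · exact hC.prodSpan_right_le h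
    · exact (prodSpan_mono (rightClosure_prodSpan_le P W i) le_rfl).trans h
  · rw [le_rightTransporter]
    refine (hL.prodSpan_prodSpan_left _ _ _).trans (sup_le ?_ ?_)
    · exact (prodSpan_mono (rightClosure_prodSpan_le P W i) le_rfl).trans h
    · exact hC.prodSpan_right_le h

end Words

/-! ### Bounded solvability from vanishing of independent words -/

section Solvability

open scoped Pointwise

variable {K L : Type*} [Field K] [NonUnitalNonAssocRing L] [Module K L]
  [IsScalarTower K L L] [SMulCommClass K L L] {n : ℕ} [NeZero n]

local infixl:70 " ⋄ " => prodSpan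

/-- The first `B + 1` terms of the progression are distinct, too many for `S`. -/
theorem exists_add_nsmul_notMem {d : ZMod n} {B : ℕ} (hd : B < addOrderOf d) (a : ZMod n)
    (S : Finset (ZMod n)) (hS : S.card ≤ B) : ∃ k ≤ B, a + k • d ∉ S := by
  by_contra! h
  have hinj : Set.InjOn (fun k : ℕ => a + k • d) (Finset.range (B + 1)) := by
    intro k hk k' hk' e
    have e' : k • d = k' • d := add_left_cancel e
    simp only [Finset.coe_range, Set.mem_Iio] at hk hk'
    exact nsmul_injOn_Iio_addOrderOf (by simp; omega) (by simp; omega) e'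
  have := Finset.card_le_card_of_injOn (s := Finset.range (B + 1)) (t := S) _
    (fun k hk => h k (by simpa [Nat.lt_succ_iff] using hk)) hinj
  rw [Finset.card_range] at this
  omega

/-- The first `k` letters move the degree off the resonances of `c` copies of `d`; the next `c`
letters then complete an independent word. The remaining letters only pad the length. -/
theorem wordSpan_replicate_le {H : Type*} [Group H] [Fintype H] {χ : H →* (ZMod n)ˣ}
    (hχ : IsFixedPointFree χ) {P : ZMod n → Submodule K L}
    (hP : ∀ i j, P i ⋄ P j ≤ P (i + j)) {C : Submodule K L} (hC : IsIdealOf C) {c : ℕ}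
    (hsel : ∀ a (l : List (ZMod n)), l.length = c → IsIndep χ (a ::ₘ (l : Multiset _)) →
      wordSpan P (P a) l ≤ C) {d : ZMod n}
    (hd : IsIndep χ (List.replicate c d : Multiset _))
    (hord : Fintype.card H ^ (2 * c + 1) < addOrderOf d) (a : ZMod n) :
    wordSpan P (P a) (List.replicate (Fintype.card H ^ (2 * c + 1) + c) d) ≤ C := by
  obtain ⟨k, hk, hres⟩ := exists_add_nsmul_notMem hord a (resonances χ (List.replicate c d))
    (by simpa using card_resonances_le χ (List.replicate c d))
  have hsplit : List.replicate (Fintype.card H ^ (2 * c + 1) + c) d = List.replicate k d ++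
      (List.replicate c d ++ List.replicate (Fintype.card H ^ (2 * c + 1) - k) d) := by
    simp only [List.replicate_append_replicate]
    congr 1
    omega
  rw [hsplit, wordSpan_append, wordSpan_append]
  refine wordSpan_le_of_stable (fun i => hC.prodSpan_right_le le_rfl) ?_ _
  refine (wordSpan_mono P (wordSpan_le_component hP le_rfl _) _).trans ?_
  rw [List.sum_replicate]
  exact hsel _ _ (by simp) (isIndep_cons hχ hd hres)

/-- If a homogeneous subspace `W` is annihilated modulo `C` by the right multiplications by almost
all components, and long products with equal factors of large order vanish modulo `C`, then
the right ideal generated by `W` has few nontrivial components modulo `C`. -/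
theorem exists_support (hL : IsLieTypeAlgebra K L) {P : ZMod n → Submodule K L}
    (hP : ∀ i j, P i ⋄ P j ≤ P (i + j)) {C : Submodule K L} (hC : IsIdealOf C) {N w : ℕ}
    (hlarge : ∀ d, N < addOrderOf d → ∀ a, wordSpan P (P a) (List.replicate w d) ≤ C)
    {W : Submodule K L} {b : ZMod n} (hW : W ≤ P b) (D : Finset (ZMod n))
    (hD : ∀ j ∉ D, W ⋄ P j ≤ C) :
    ∃ S : Finset (ZMod n), S.card ≤ (N + w + 1) ^ D.card ∧
      ∀ l : List (ZMod n), b + l.sum ∉ S → wordSpan P W l ≤ C := by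
  classical
  have hCP : ∀ i, C ⋄ P i ≤ C := fun i => hC.prodSpan_right_le le_rfl
  -- Possible degrees of surviving words: letters are in `D`, and multiplicities can be taken at
  -- most `N + w`.
  let S : Finset (ZMod n) := Finset.univ.image
    fun g : D → Fin (N + w + 1) => b + ∑ d : D, (g d : ℕ) • (d : ZMod n)
  refine ⟨S, Finset.card_image_le.trans (by simp), ?_⟩
  suffices h : ∀ m : ℕ, ∀ l : List (ZMod n), l.length = m → b + l.sum ∉ S → wordSpan P W l ≤ C from
    fun l => h _ l rfl
  intro m
  induction m using Nat.strong_induction_on with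
  | _ m ih =>
    intro l hl hS
    have hperm : ∀ l', l.Perm l' → wordSpan P W l' ≤ C → wordSpan P W l ≤ C := fun l' hp h =>
      wordSpan_le_of_perm hL hP (N := m) (e := l.sum)
        (fun l'' hlt hsum => ih _ hlt l'' rfl (by rwa [hsum])) hp [] hl rfl h
    by_cases h1 : ∃ j ∈ l, j ∉ D
    · obtain ⟨j, hj, hjD⟩ := h1
      refine hperm _ (List.perm_cons_erase hj) ?_
      exact wordSpan_le_of_stable hCP (hD j hjD) _
    push Not at h1
    by_cases h2 : ∃ d, N < addOrderOf d ∧ w ≤ l.count d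
    · obtain ⟨d, hd, hw⟩ := h2
      obtain ⟨l', hl'⟩ := (List.replicate_sublist_iff.2 hw).exists_perm_append
      refine hperm _ hl' ?_
      rw [wordSpan_append]
      exact wordSpan_le_of_stable hCP ((wordSpan_mono P hW _).trans (hlarge d hd b)) _
    push Not at h2
    exfalso
    -- A letter of order above `N` occurs fewer than `w` times; the multiplicity of any other letter
    -- matters for the degree only modulo its order, which is at most `N`.
    refine hS (Finset.mem_image.2 ⟨fun d => ⟨if N < addOrderOf (d : ZMod n) then l.count (d : ZMod n)
      else l.count (d : ZMod n) % addOrderOf (d : ZMod n), ?_⟩, Finset.mem_univ _, ?_⟩)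
    · split_ifs with h
      · have := h2 _ h
        omega
      · have := Nat.mod_lt (l.count (d : ZMod n)) (addOrderOf_pos (d : ZMod n))
        omega
    · congr 1
      rw [Finset.sum_list_count_of_subset l D (fun x hx => h1 x (List.mem_toFinset.1 hx)),
        ← Finset.sum_coe_sort D fun d => l.count d • d]
      refine Finset.sum_congr rfl fun d _ => ?_
      dsimp only
      split_ifs
      · rfl
      · rw [mod_addOrderOf_nsmul]

/-- Modulo the annihilator of the right ideal generated by `W`, a component can be nonzero only in a
degree that is a difference of two degrees of the support `S`. Kreknin's theorem then has a bound
independent of `n`. -/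
theorem rightClosure_prodSpan_derivedFamily_le (hL : IsLieTypeAlgebra K L)
    {P : ZMod n → Submodule K L} (hP : ∀ i j, P i ⋄ P j ≤ P (i + j)) (htop : ⨆ i, P i = ⊤)
    {C : Submodule K L} (hC : IsIdealOf C) (h0 : P 0 ≤ C) {N w m : ℕ}
    (hlarge : ∀ d, N < addOrderOf d → ∀ a, wordSpan P (P a) (List.replicate w d) ≤ C)
    {W : Submodule K L} {b : ZMod n} (hW : W ≤ P b) (D : Finset (ZMod n)) (hDm : D.card ≤ m)
    (hD : ∀ j ∉ D, W ⋄ P j ≤ C) {s : ℕ} (hs : 2 ^ ((N + w + 1) ^ m * (N + w + 1) ^ m) ≤ s)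
    (i : ZMod n) :
    rightClosure P W ⋄ derivedFamily^[s] P i ≤ C := by
  classical
  obtain ⟨S, hScard, hS⟩ := exists_support hL hP hC hlarge hW D hD
  have hScard' : S.card ≤ (N + w + 1) ^ m :=
    hScard.trans (Nat.pow_le_pow_right (Nat.succ_pos _) hDm)
  let Cr := rightTransporter (rightClosure P W) C
  have hT : ∀ j ∉ S - S, P j ≤ Cr := by
    intro j hj
    rw [le_rightTransporter, rightClosure, iSup_prodSpan]
    refine iSup_le fun l => ?_
    by_cases hl : b + l.sum ∈ S
    · rw [← wordSpan_concat]
      refine hS _ fun h => hj ?_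
      rw [List.sum_append, List.sum_singleton, ← add_assoc] at h
      have := Finset.sub_mem_sub h hl
      rwa [add_sub_cancel_left] at this
    · exact hC.prodSpan_right_le (hS l hl)
  have hcard : (S - S).card ≤ (N + w + 1) ^ m * (N + w + 1) ^ m :=
    Finset.card_sub_le.trans (Nat.mul_le_mul hScard' hScard')
  have hder : derivedFamily P ≤ P := derivedFamily_le.2 hP
  have hkr := derivedFamily_iterate_le_ideal hL
    (isIdealOf_rightTransporter_rightClosure hL htop hC W) hder
    (le_rightTransporter.2 (hC.prodSpan_left_le h0)) (S - S) hT i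
  have hss : 2 ^ (S - S).card ≤ s := (Nat.pow_le_pow_right (by norm_num) hcard).trans hs
  exact le_rightTransporter.1 ((derivedFamily_iterate_le_of_le hder hss i).trans hkr)

/-- One step of the induction for solvability: from products of `c + 1` factors to products
of `c + 2` factors. -/
theorem derivedFamily_iterate_le_succ (hL : IsLieTypeAlgebra K L) {H : Type*} [Group H]
    [Fintype H] {χ : H →* (ZMod n)ˣ} (hχ : IsFixedPointFree χ) {P : ZMod n → Submodule K L}
    (hP : ∀ i j, P i ⋄ P j ≤ P (i + j)) (htop : ⨆ i, P i = ⊤)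
    {C : Submodule K L} (hC : IsIdealOf C) (h0 : P 0 ≤ C) {N w c : ℕ}
    (hlarge : ∀ d, N < addOrderOf d → ∀ a, wordSpan P (P a) (List.replicate w d) ≤ C)
    (hsel : ∀ a (l : List (ZMod n)), l.length = c + 1 → IsIndep χ (a ::ₘ (l : Multiset _)) →
      wordSpan P (P a) l ≤ C) {s : ℕ}
    (hs : ∀ m, m = 2 * Fintype.card H ^ (2 * (c + 1) + 1) →
      2 ^ ((N + w + 1) ^ m * (N + w + 1) ^ m) ≤ s)
    (ih : ∀ I : Submodule K L, IsIdealOf I → P 0 ≤ I →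
      (∀ a (l : List (ZMod n)), l.length = c → IsIndep χ (a ::ₘ (l : Multiset _)) →
        wordSpan P (P a) l ≤ I) → ∀ i, derivedFamily^[s] P i ≤ I) (i : ZMod n) :
    derivedFamily^[s + 1] P i ≤ C := by
  classical
  let ι := {p : ZMod n × List (ZMod n) // p.2.length = c ∧ IsIndep χ (p.1 ::ₘ (p.2 : Multiset _))}
  let U : ι → Submodule K L := fun p => wordSpan P (P p.1.1) p.1.2
  let D : ι → Finset (ZMod n) := fun p => resonances χ (p.1.1 :: p.1.2)
  have hDcard : ∀ p, (D p).card ≤ Fintype.card H ^ (2 * (c + 1) + 1) := fun p => by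
    have := card_resonances_le χ (p.1.1 :: p.1.2)
    rwa [List.length_cons, p.2.1] at this
  have hUcomp : ∀ p, U p ≤ P (p.1.1 + p.1.2.sum) := fun p => wordSpan_le_component hP le_rfl _
  have hUr : ∀ p, ∀ j ∉ D p, U p ⋄ P j ≤ C := by
    intro p j hj
    rw [← wordSpan_concat]
    refine hsel _ _ (by simp [p.2.1]) ?_
    have := isIndep_cons hχ (l := p.1.1 :: p.1.2) p.2.2 hj
    convert this using 1
    rw [Multiset.cons_coe, Multiset.cons_coe, Multiset.coe_eq_coe]
    exact List.perm_append_singleton j (p.1.1 :: p.1.2)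
  have hUl : ∀ p, ∀ j ∉ D p, P j ⋄ U p ≤ C := by
    intro p j hj
    refine prodSpan_wordSpan_le hL _ _ _ fun l' hl' => hsel _ _ ?_ ?_
    · rw [hl'.length_eq, List.length_cons, p.2.1]
    · rw [Multiset.coe_eq_coe.2 hl']
      exact isIndep_cons hχ (l := p.1.1 :: p.1.2) p.2.2 hj
  -- The ideal generated modulo `C` by independent words with `c + 1` factors. Single left multiples
  -- suffice, because further left factors are absorbed by the identity.
  let I : Submodule K L :=
    C ⊔ ⨆ p, (rightClosure P (U p) ⊔ ⨆ d, rightClosure P (P d ⋄ U p))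
  have hCI : C ≤ I := le_sup_left
  have hUI : ∀ p, rightClosure P (U p) ≤ I := fun p =>
    le_sup_of_le_right (le_iSup_of_le p le_sup_left)
  have hLUI : ∀ p d, rightClosure P (P d ⋄ U p) ≤ I := fun p d =>
    le_sup_of_le_right (le_iSup_of_le p (le_sup_of_le_right
      (le_iSup (fun d => rightClosure P (P d ⋄ U p)) d)))
  have hIr : ∀ i, I ⋄ P i ≤ I := by
    intro i
    simp only [I, sup_prodSpan, iSup_prodSpan]
    refine sup_le ((hC.prodSpan_right_le le_rfl).trans hCI) (iSup_le fun p => sup_le ?_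
      (iSup_le fun d => ?_))
    · exact (rightClosure_prodSpan_le _ _ _).trans (hUI p)
    · exact (rightClosure_prodSpan_le _ _ _).trans (hLUI p d)
  have hIl : ∀ i, P i ⋄ I ≤ I := by
    intro i
    have h1 : ∀ p d, P d ⋄ U p ≤ I := fun p d => (wordSpan_le_rightClosure P _ []).trans (hLUI p d)
    have : P i ⋄ I = P i ⋄ C ⊔ ⨆ p, (P i ⋄ rightClosure P (U p) ⊔
        ⨆ d, P i ⋄ rightClosure P (P d ⋄ U p)) := by
      simp only [I, prodSpan_sup, prodSpan_iSup]
    rw [this]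
    refine sup_le ((hC.prodSpan_left_le le_rfl).trans hCI) (iSup_le fun p => sup_le ?_
      (iSup_le fun d => ?_))
    · exact prodSpan_rightClosure_le hL hP hIr (h1 p) i
    · refine prodSpan_rightClosure_le hL hP hIr (fun j => ?_) i
      refine (hL.prodSpan_prodSpan_left _ _ _).trans (sup_le ?_ ?_)
      · exact (prodSpan_mono (hP j d) le_rfl).trans (h1 p _)
      · exact (prodSpan_mono (h1 p j) le_rfl).trans (hIr d)
  have hI : IsIdealOf I := isIdealOf_of_iSup_eq_top htop hIr hIl
  have hDI := ih I hI (h0.trans hCI) fun a l hl hind =>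
    (wordSpan_le_rightClosure P (wordSpan P (P a) l) []).trans (hUI ⟨(a, l), hl, hind⟩)
  -- The `s`-th derived family lies in `I` and is annihilated by `I` modulo `C`, so one more derived
  -- step lands in `C`.
  have hann : ∀ j, I ⋄ derivedFamily^[s] P j ≤ C := by
    intro j
    simp only [I, sup_prodSpan, iSup_prodSpan]
    refine sup_le (hC.prodSpan_right_le le_rfl) (iSup_le fun p => sup_le ?_ (iSup_le fun d => ?_))
    · exact rightClosure_prodSpan_derivedFamily_le hL hP htop hC h0 hlarge (hUcomp p) (D p)
        ((hDcard p).trans (by omega)) (hUr p) (hs _ rfl) j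
    · refine rightClosure_prodSpan_derivedFamily_le hL hP htop hC h0 hlarge
        (b := d + (p.1.1 + p.1.2.sum)) ?_ (D p ∪ (D p).image fun x => x - d) ?_ ?_ (hs _ rfl) j
      · exact (prodSpan_mono le_rfl (hUcomp p)).trans (hP _ _)
      · refine (Finset.card_union_le _ _).trans ?_
        have := (Finset.card_image_le (s := D p) (f := fun x => x - d)).trans (hDcard p)
        have := hDcard p
        omega
      · intro j hj
        rw [Finset.mem_union, not_or] at hj
        refine (hL.prodSpan_prodSpan_right _ _ _).trans (sup_le ?_ ?_)
        · exact hC.prodSpan_left_le (hUr p j hj.1)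
        · refine (prodSpan_mono (hP d j) le_rfl).trans (hUl p _ fun h => hj.2 ?_)
          exact Finset.mem_image.2 ⟨_, h, by abel⟩
  rw [Function.iterate_succ_apply']
  exact iSup_le fun j => (prodSpan_mono (hDI j) le_rfl).trans (hann _)

/-- A graded Lie type algebra with trivial zero component in which the left-normed products of
components with independent indices of a fixed length vanish is solvable of bounded length. -/
theorem exists_derivedFamily_iterate_le (q : ℕ) (hq : 0 < q) (c : ℕ) :
    ∃ s : ℕ, ∀ (K L H : Type*) [Field K] [NonUnitalNonAssocRing L] [Module K L]
      [IsScalarTower K L L] [SMulCommClass K L L] [Group H] [Fintype H] (n : ℕ) [NeZero n]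
      (χ : H →* (ZMod n)ˣ) (P : ZMod n → Submodule K L) (C : Submodule K L),
      IsLieTypeAlgebra K L → Fintype.card H = q → IsFixedPointFree χ →
      (∀ i j, prodSpan (P i) (P j) ≤ P (i + j)) → ⨆ i, P i = ⊤ → IsIdealOf C → P 0 ≤ C →
      (∀ a (l : List (ZMod n)), l.length = c → IsIndep χ (a ::ₘ (l : Multiset _)) →
        wordSpan P (P a) l ≤ C) →
      ∀ i, derivedFamily^[s] P i ≤ C := by
  induction c with
  | zero =>
    refine ⟨0, fun K L H _ _ _ _ _ _ _ n _ χ P C hL hH hχ hP htop hC h0 hsel i => ?_⟩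
    by_cases hi : i = 0
    · subst hi
      exact h0
    · exact hsel i [] rfl (isIndep_singleton hχ hi)
  | succ c ih =>
    obtain ⟨s₀, hs₀⟩ := ih
    obtain ⟨N₀, -, hN₀⟩ := exists_isIndep_replicate q (c + 1) hq
    set B := q ^ (2 * (c + 1) + 1) with hB
    set w := B + (c + 1) with hw
    set N := max N₀ B with hN
    set s₁ := 2 ^ ((N + w + 1) ^ (2 * B) * (N + w + 1) ^ (2 * B)) with hs₁
    refine ⟨max s₀ s₁ + 1, fun K L H _ _ _ _ _ _ _ n _ χ P C hL hH hχ hP htop hC h0 hsel i => ?_⟩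
    have hder : derivedFamily P ≤ P := derivedFamily_le.2 hP
    refine derivedFamily_iterate_le_succ hL hχ hP htop hC h0 (N := N) (w := w)
      (fun d hd a => ?_) hsel (fun m hm => ?_) (fun I hI hI0 hIsel i => ?_) i
    · have := wordSpan_replicate_le hχ hP hC hsel
        (hN₀ n H χ hH hχ d (lt_of_le_of_lt (le_max_left _ _) hd))
        (by rw [hH]; exact lt_of_le_of_lt (le_max_right _ _) hd) a
      rwa [hH] at this
    · rw [hm, hH]
      exact le_max_right _ _
    · exact (derivedFamily_iterate_le_of_le hder (le_max_left s₀ s₁) i).trans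
        (hs₀ K L H n χ P I hL hH hχ hP htop hI hI0 hIsel i)

end Solvability

/-! ### Rearranging and splitting words -/

section WordLemmas

variable {K L : Type*} [Field K] [NonUnitalNonAssocRing L] [Module K L]
  [IsScalarTower K L L] [SMulCommClass K L L] {A : Type*}

local infixl:70 " ⋄ " => prodSpan

theorem exists_le_count {l : List A} [DecidableEq A] [Nonempty A] (D : Finset A)
    (hD : ∀ a ∈ l, a ∈ D) {B w : ℕ} (hB : 0 < B) (hDB : D.card ≤ B) (hl : B * w ≤ l.length) :
    ∃ d, w ≤ l.count d := by
  by_contra! h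
  have h1 : ∑ d ∈ D, l.count d = l.length := by
    have := Multiset.sum_count_eq_card (s := D) (m := (l : Multiset A)) (by simpa using hD)
    simpa using this
  have hw : 0 < w := lt_of_le_of_lt (Nat.zero_le _) (h (Classical.arbitrary A))
  have h2 : ∑ d ∈ D, l.count d ≤ D.card * (w - 1) := by
    rw [← smul_eq_mul]
    exact Finset.sum_le_card_nsmul _ _ _ fun d _ => Nat.le_sub_one_of_lt (h d)
  have h3 : D.card * (w - 1) ≤ B * (w - 1) := Nat.mul_le_mul_right _ hDB
  have h4 : B * (w - 1) < B * w := Nat.mul_lt_mul_of_pos_left (by omega) hB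
  omega

theorem wordSpan_mono_left {P Q : A → Submodule K L} (h : P ≤ Q) {W W' : Submodule K L}
    (hW : W ≤ W') (l : List A) : wordSpan P W l ≤ wordSpan Q W' l := by
  induction l generalizing W W' with
  | nil => exact hW
  | cons i l ih => exact ih (prodSpan_mono hW (h i))

/-- Permuting the letters of a word does not matter modulo `M'` if products of letters act trivially
from `M` to `M / M'`. -/
theorem wordSpan_le_of_perm_of_stable (hL : IsLieTypeAlgebra K L) {Q : A → Submodule K L}
    {M M' : Submodule K L} (hM : ∀ i, M ⋄ Q i ≤ M) (hM' : ∀ i, M' ⋄ Q i ≤ M')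
    (hMQ : ∀ i j, M ⋄ (Q i ⋄ Q j) ≤ M') {l l' : List A} (hp : l.Perm l') :
    ∀ W ≤ M, wordSpan Q W l' ≤ M' → wordSpan Q W l ≤ M' := by
  induction hp with
  | nil => exact fun _ _ h => h
  | cons a _ ih => exact fun W hW h => ih _ ((prodSpan_mono hW le_rfl).trans (hM a)) h
  | swap a b l =>
    intro W hW h
    simp only [wordSpan_cons] at h ⊢
    refine (wordSpan_mono Q (hL.prodSpan_prodSpan_right W (Q b) (Q a)) l).trans ?_
    rw [wordSpan_sup]
    refine sup_le (wordSpan_le_of_stable hM' ?_ l) h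
    exact (prodSpan_mono hW le_rfl).trans (hMQ b a)
  | trans _ _ ih1 ih2 => exact fun W hW h => ih1 W hW (ih2 W hW h)

theorem wordSpan_replicate_le_iSup {B : Type*} {Q : A → Submodule K L} {T : B → Submodule K L}
    {b : A} (h : Q b ≤ ⨆ i, T i) (W : Submodule K L) (m : ℕ) :
    wordSpan Q W (List.replicate m b) ≤ ⨆ l : {l : List B // l.length = m}, wordSpan T W l.1 := by
  induction m with
  | zero => exact le_iSup_of_le ⟨[], rfl⟩ le_rfl
  | succ m ih =>
    rw [List.replicate_succ', wordSpan_concat]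
    refine (prodSpan_mono ih h).trans ?_
    rw [iSup_prodSpan]
    refine iSup_le fun l => ?_
    rw [prodSpan_iSup]
    refine iSup_le fun i => ?_
    rw [← wordSpan_concat]
    exact le_iSup_of_le ⟨l.1 ++ [i], by simp [l.2]⟩ le_rfl

theorem map_prodSpan {ψ : Module.End K L} (hψ : ∀ x y, ψ (x * y) = ψ x * ψ y)
    (V W : Submodule K L) : (V ⋄ W).map ψ = V.map ψ ⋄ W.map ψ := by
  apply le_antisymm
  · rw [Submodule.map_le_iff_le_comap, prodSpan_le]
    intro x hx y hy
    rw [Submodule.mem_comap, hψ]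
    exact mul_mem_prodSpan (Submodule.mem_map_of_mem hx) (Submodule.mem_map_of_mem hy)
  · rw [prodSpan_le]
    rintro _ ⟨x, hx, rfl⟩ _ ⟨y, hy, rfl⟩
    rw [← hψ]
    exact Submodule.mem_map_of_mem (mul_mem_prodSpan hx hy)

theorem map_wordSpan {ψ : Module.End K L} (hψ : ∀ x y, ψ (x * y) = ψ x * ψ y)
    (Q : A → Submodule K L) (W : Submodule K L) (l : List A) :
    (wordSpan Q W l).map ψ = wordSpan (fun i => (Q i).map ψ) (W.map ψ) l := by
  induction l generalizing W with
  | nil => rfl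
  | cons i l ih => rw [wordSpan_cons, ih, map_prodSpan hψ, wordSpan_cons]

/-- The left-normed product `[x, y₁, …, yₖ]` of elements. -/
def leftNormed (x : L) : List L → L
  | [] => x
  | y :: ys => leftNormed (x * y) ys

theorem leftNormed_add (ys : List L) (x y : L) :
    leftNormed (x + y) ys = leftNormed x ys + leftNormed y ys := by
  induction ys generalizing x y with
  | nil => rfl
  | cons z ys ih => simp only [leftNormed, add_mul, ih]

theorem leftNormed_smul (k : K) (ys : List L) (x : L) :
    leftNormed (k • x) ys = k • leftNormed x ys := by
  induction ys generalizing x with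
  | nil => rfl
  | cons z ys ih => simp only [leftNormed, smul_mul_assoc, ih]

theorem wordSpan_le_of_forall {Q : A → Submodule K L} {C : Submodule K L} (l : List A) :
    ∀ W : Submodule K L,
      (∀ x ∈ W, ∀ ys : List L, List.Forall₂ (fun y i => y ∈ Q i) ys l → leftNormed x ys ∈ C) →
        wordSpan Q W l ≤ C := by
  induction l with
  | nil => exact fun W h x hx => h x hx [] List.Forall₂.nil
  | cons i l ih =>
    intro W h
    refine ih _ fun z hz ys hys => ?_
    let f : Module.End K L :=
      { toFun := fun x => leftNormed x ys
        map_add' := leftNormed_add ys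
        map_smul' := fun k => leftNormed_smul k ys }
    have hle : W ⋄ Q i ≤ C.comap f := by
      rw [prodSpan_le]
      intro x hx y hy
      exact h x hx (y :: ys) (List.Forall₂.cons hy hys)
    exact hle hz

end WordLemmas

/-! ### Gradings with an `H`-action, and traces -/

section Traces

/-- A Lie type algebra graded by the eigenspaces of an automorphism `φ` with trivial fixed points,
whose components are permuted by a group `H` of automorphisms. -/
structure FrobeniusGrading (K L H : Type*) [Field K] [NonUnitalNonAssocRing L] [Module K L]
    [Group H] (n : ℕ) where
  χ : H →* (ZMod n)ˣ
  free : IsFixedPointFree χ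
  P : ZMod n → Submodule K L
  indep : iSupIndep P
  iSup_eq_top : ⨆ i, P i = ⊤
  mul_le : ∀ i j, prodSpan (P i) (P j) ≤ P (i + j)
  zero : P 0 = ⊥
  φ : Module.End K L
  φ_mul : ∀ x y, φ (x * y) = φ x * φ y
  ζ : ZMod n → K
  ζ_injective : Function.Injective ζ
  ζ_ne_zero : ∀ i, ζ i ≠ 0
  φ_apply : ∀ i, ∀ x ∈ P i, φ x = ζ i • x
  ρ : H →* Module.End K L
  ρ_mul : ∀ h x y, ρ h (x * y) = ρ h x * ρ h y
  ρ_mem : ∀ h i, ∀ x ∈ P i, ρ h x ∈ P ((χ h : ZMod n) * i)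

variable {K L H : Type*} [Field K] [NonUnitalNonAssocRing L] [Module K L]
  [IsScalarTower K L L] [SMulCommClass K L L] [Group H] [Fintype H] {n : ℕ} [NeZero n]

local infixl:70 " ⋄ " => prodSpan

namespace FrobeniusGrading

variable (G : FrobeniusGrading K L H n)

/-- The sum of the images of an element under `H`. -/
def tr : Module.End K L := ∑ h, G.ρ h

theorem tr_apply (x : L) : G.tr x = ∑ h, G.ρ h x := by
  simp [tr]

theorem ρ_tr (h : H) (x : L) : G.ρ h (G.tr x) = G.tr x := by
  rw [tr_apply, map_sum]
  refine Fintype.sum_equiv (Equiv.mulLeft h) _ _ fun g => ?_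
  simp

/-- The left-normed products of `c + 1` fixed points of `H` are trivial. -/
def FixedNilpotent (c : ℕ) : Prop :=
  ∀ x : L, (∀ h, G.ρ h x = x) → ∀ ys : List L, (∀ y ∈ ys, ∀ h, G.ρ h y = y) → ys.length = c →
    leftNormed x ys = 0

/-- The span of the components with indices in `S`. -/
def spanOf (S : Set (ZMod n)) : Submodule K L := ⨆ i ∈ S, G.P i

theorem mem_spanOf {S : Set (ZMod n)} {i : ZMod n} (hi : i ∈ S) {x : L} (hx : x ∈ G.P i) :
    x ∈ G.spanOf S :=
  (le_biSup G.P hi : G.P i ≤ G.spanOf S) hx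

theorem disjoint_spanOf {S T : Set (ZMod n)} (h : Disjoint S T) :
    Disjoint (G.spanOf S) (G.spanOf T) :=
  G.indep.disjoint_biSup_biSup h

theorem spanOf_mono {S T : Set (ZMod n)} (h : S ⊆ T) : G.spanOf S ≤ G.spanOf T :=
  biSup_mono h

theorem spanOf_prodSpan_le {S T : Set (ZMod n)} {b : ZMod n} (h : ∀ s ∈ S, s + b ∈ T) :
    G.spanOf S ⋄ G.P b ≤ G.spanOf T := by
  simp only [spanOf, iSup_prodSpan]
  exact iSup₂_le fun s hs => (G.mul_le s b).trans (le_biSup G.P (h s hs))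

/-- Multiplication by the trace of an element of degree `b` spreads a degree over its translates by
the orbit of `b`; only supports are tracked. -/
theorem leftNormed_tr_mem (l : List (ZMod n)) :
    ∀ (S T : Set (ZMod n)), (∀ s ∈ S, ∀ t ∈ orbitSums G.χ l, s + t ∈ T) → ∀ x ∈ G.spanOf S,
      ∀ ys : List L, List.Forall₂ (fun y i => y ∈ G.P i) ys l →
        leftNormed x (ys.map G.tr) ∈ G.spanOf T := by
  induction l with
  | nil =>
    intro S T h x hx ys hys
    cases hys
    exact G.spanOf_mono (fun s hs => by simpa [orbitSums] using h s hs) hx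
  | cons b l ih =>
    intro S T h x hx ys hys
    cases hys with
    | cons hy hys =>
      refine ih {e | ∃ s ∈ S, ∃ h : H, e = s + (G.χ h : ZMod n) * b} T ?_ (x * G.tr _) ?_ _ hys
      · rintro _ ⟨s, hs, g, rfl⟩ t ht
        rw [add_assoc]
        exact h s hs _ (Finset.mem_image₂_of_mem (Finset.mem_univ g) ht)
      · rw [tr_apply, Finset.mul_sum]
        refine Submodule.sum_mem _ fun g _ => ?_
        refine G.spanOf_prodSpan_le (b := (G.χ g : ZMod n) * b) ?_
          (mul_mem_prodSpan hx (G.ρ_mem g b _ hy))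
        exact fun s hs => ⟨s, hs, g, rfl⟩

theorem FixedNilpotent.leftNormed_tr_eq_zero {G : FrobeniusGrading K L H n} {c : ℕ}
    (hG : G.FixedNilpotent c) (x : L) (ys : List L) (hys : ys.length = c) :
    leftNormed (G.tr x) (ys.map G.tr) = 0 := by
  refine hG _ (fun h => G.ρ_tr h x) _ (fun y hy h => ?_) (by simpa using hys)
  obtain ⟨z, -, rfl⟩ := List.mem_map.1 hy
  exact G.ρ_tr h z

/-- Off resonances the first factor need not be a trace: the contributions of `x` and of its other
`H`-images to the vanishing product of traces have disjoint supports. -/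
theorem FixedNilpotent.leftNormed_eq_zero_of_notMem_resonances {G : FrobeniusGrading K L H n} {c : ℕ}
    (hG : G.FixedNilpotent c) {a : ZMod n} {l : List (ZMod n)} (hl : l.length = c)
    (ha : a ∉ resonances G.χ l) {x : L} (hx : x ∈ G.P a) {ys : List L}
    (hys : List.Forall₂ (fun y i => y ∈ G.P i) ys l) : leftNormed x (ys.map G.tr) = 0 := by
  classical
  let S : Set (ZMod n) := {e | ∃ t ∈ orbitSums G.χ l, e = a + t}
  let T : Set (ZMod n) := {e | ∃ h : H, h ≠ 1 ∧ ∃ t ∈ orbitSums G.χ l, e = (G.χ h : ZMod n) * a + t}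
  have hST : Disjoint S T := by
    rw [Set.disjoint_left]
    rintro _ ⟨s, hs, rfl⟩ ⟨h, hh, t, ht, e⟩
    exact ha (mem_resonances G.free hh ht hs e.symm)
  have h1 : leftNormed x (ys.map G.tr) ∈ G.spanOf S :=
    G.leftNormed_tr_mem l {a} S (by rintro _ rfl t ht; exact ⟨t, ht, rfl⟩) x
      (G.mem_spanOf (Set.mem_singleton _) hx) ys hys
  have h2 : leftNormed (∑ h ∈ Finset.univ.erase (1 : H), G.ρ h x) (ys.map G.tr) ∈ G.spanOf T := by
    let R : Set (ZMod n) := {e | ∃ h : H, h ≠ 1 ∧ e = (G.χ h : ZMod n) * a}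
    have hR : ∀ h ∈ Finset.univ.erase (1 : H), G.ρ h x ∈ G.spanOf R := fun h hh =>
      G.mem_spanOf (show (G.χ h : ZMod n) * a ∈ R from ⟨h, Finset.ne_of_mem_erase hh, rfl⟩)
        (G.ρ_mem h a x hx)
    refine G.leftNormed_tr_mem l R T ?_ _ (Submodule.sum_mem _ hR) ys hys
    rintro _ ⟨h, hh, rfl⟩ t ht
    exact ⟨h, hh, t, ht, rfl⟩
  have h3 : x + ∑ h ∈ Finset.univ.erase (1 : H), G.ρ h x = G.tr x := by
    rw [tr_apply, ← Finset.add_sum_erase _ _ (Finset.mem_univ (1 : H))]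
    simp
  have h4 := hG.leftNormed_tr_eq_zero x ys (hys.length_eq.trans hl)
  rw [← h3, leftNormed_add] at h4
  refine Submodule.disjoint_def.1 (G.disjoint_spanOf hST) _ h1 ?_
  rw [eq_neg_of_add_eq_zero_left h4]
  exact Submodule.neg_mem _ h2

/-- The twisted sums of a multiset of residues with a nontrivial twist. -/
def nontrivialTwistSums (s : Multiset (ZMod n)) : Set (ZMod n) :=
  {e | ∃ m : Multiset (H × ZMod n), m.map Prod.snd = s ∧ twistSum G.χ m = e ∧ ∃ p ∈ m, p.1 ≠ 1}

/-- Expansion of a product of traces: the untwisted term is split off, and all others keep a record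
of a nontrivial twist. -/
theorem leftNormed_tr_sub_mem (l : List (ZMod n)) :
    ∀ (s : Multiset (ZMod n)) (X x : L), x ∈ G.P s.sum →
      X - x ∈ G.spanOf (G.nontrivialTwistSums s) →
      ∀ ys : List L, List.Forall₂ (fun y i => y ∈ G.P i) ys l →
        leftNormed x ys ∈ G.P (s + l).sum ∧
          leftNormed X (ys.map G.tr) - leftNormed x ys ∈
            G.spanOf (G.nontrivialTwistSums (s + l)) := by
  classical
  induction l with
  | nil =>
    intro s X x hx hX ys hys
    cases hys
    rw [Multiset.coe_nil, add_zero]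
    exact ⟨hx, hX⟩
  | cons b l ih =>
    intro s X x hx hX ys hys
    cases hys with
    | @cons y _ _ _ hy hys =>
      have hs : s + ((b :: l : List (ZMod n)) : Multiset (ZMod n)) = (b ::ₘ s) + l := by
        rw [← Multiset.cons_coe, Multiset.add_cons, Multiset.cons_add]
      rw [hs]
      refine ih (b ::ₘ s) (X * G.tr y) (x * y) ?_ ?_ _ hys
      · rw [Multiset.sum_cons, add_comm]
        exact G.mul_le _ _ (mul_mem_prodSpan hx hy)
      · have hsplit : X * G.tr y - x * y =
            ∑ h, (X - x) * G.ρ h y + ∑ h ∈ Finset.univ.erase (1 : H), x * G.ρ h y := by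
          have h3 : y + ∑ h ∈ Finset.univ.erase (1 : H), G.ρ h y = G.tr y := by
            rw [tr_apply, ← Finset.add_sum_erase _ _ (Finset.mem_univ (1 : H))]
            simp
          rw [← Finset.mul_sum, ← Finset.mul_sum, ← tr_apply, eq_sub_of_add_eq' h3, sub_mul,
            mul_sub]
          abel
        rw [hsplit]
        refine Submodule.add_mem _ (Submodule.sum_mem _ fun h _ => ?_)
          (Submodule.sum_mem _ fun h hh => ?_)
        · refine G.spanOf_prodSpan_le ?_ (mul_mem_prodSpan hX (G.ρ_mem h b y hy))
          rintro _ ⟨m, hm, rfl, p, hp, hp1⟩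
          refine ⟨(h, b) ::ₘ m, by simp [hm], ?_, p, Multiset.mem_cons_of_mem hp, hp1⟩
          simp [twistSum, add_comm]
        · refine G.mem_spanOf ?_ (G.mul_le _ _ (mul_mem_prodSpan hx (G.ρ_mem h b y hy)))
          refine ⟨(h, b) ::ₘ s.map fun a => (1, a), by simp, ?_, (h, b),
            Multiset.mem_cons_self _ _, Finset.ne_of_mem_erase hh⟩
          simp [twistSum, add_comm]

/-- Independence says that the degree of the untwisted term is not a nontrivially twisted sum, so
this term cannot cancel. -/
theorem FixedNilpotent.leftNormed_eq_zero_of_isIndep {G : FrobeniusGrading K L H n} {c : ℕ}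
    (hG : G.FixedNilpotent c) {a : ZMod n} {l : List (ZMod n)} (hl : l.length = c)
    (ha : IsIndep G.χ (a ::ₘ (l : Multiset _))) {x : L} (hx : x ∈ G.P a) {ys : List L}
    (hys : List.Forall₂ (fun y i => y ∈ G.P i) ys l) : leftNormed x ys = 0 := by
  classical
  have h := G.leftNormed_tr_sub_mem l {a} (G.tr x) x (by simpa using hx) (by
    rw [tr_apply, ← Finset.add_sum_erase _ _ (Finset.mem_univ (1 : H)), map_one,
      Module.End.one_apply, add_sub_cancel_left]
    refine Submodule.sum_mem _ fun h hh => G.mem_spanOf ?_ (G.ρ_mem h a x hx)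
    exact ⟨{(h, a)}, by simp, by simp [twistSum], (h, a), Multiset.mem_singleton_self _,
      Finset.ne_of_mem_erase hh⟩) ys hys
  rw [hG.leftNormed_tr_eq_zero x ys (hys.length_eq.trans hl), zero_sub, neg_mem_iff] at h
  rw [Multiset.singleton_add] at h
  refine Submodule.disjoint_def.1 (G.disjoint_spanOf (S := {(a ::ₘ (l : Multiset _)).sum})
    (Set.disjoint_singleton_left.2 ?_)) _ (G.mem_spanOf (Set.mem_singleton _) h.1) h.2
  rintro ⟨m, hm, hsum, p, hp, hp1⟩
  exact hp1 (ha m hm hsum p hp)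

theorem FixedNilpotent.wordSpan_eq_bot {G : FrobeniusGrading K L H n} {c : ℕ}
    (hG : G.FixedNilpotent c) {a : ZMod n} {l : List (ZMod n)} (hl : l.length = c)
    (ha : IsIndep G.χ (a ::ₘ (l : Multiset _))) : wordSpan G.P (G.P a) l ≤ ⊥ :=
  wordSpan_le_of_forall l _ fun _ hx _ hys =>
    (Submodule.mem_bot K).2 (hG.leftNormed_eq_zero_of_isIndep hl ha hx hys)

open Polynomial in
/-- A homogeneous element is a linear combination of the images of its trace under few powers
of `φ`. -/
theorem component_le_iSup_map_tr {Q : Submodule K L} {b : ZMod n} (hb : b ≠ 0) (hQ : Q ≤ G.P b) :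
    Q ≤ ⨆ i : Fin (Fintype.card H), (Q.map G.tr).map (G.φ ^ (i : ℕ)) := by
  classical
  intro y hy
  have hyb := hQ hy
  -- The images of `y` under `H` have distinct eigenvalues when `b ≠ 0`; `p` of degree `q - 1` kills
  -- all of them but `y`.
  let p : K[X] := ∏ h ∈ Finset.univ.erase (1 : H), (X - C (G.ζ ((G.χ h : ZMod n) * b)))
  have haeval : ∀ (i : ZMod n) (x : L), x ∈ G.P i → aeval G.φ p x = p.eval (G.ζ i) • x := by
    intro i x hx
    by_cases hx0 : x = 0
    · simp [hx0]
    · exact Module.End.aeval_apply_of_hasEigenvector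
        ⟨Module.End.mem_eigenspace_iff.2 (G.φ_apply i x hx), hx0⟩
  have heval : ∀ h : H, h ≠ 1 → p.eval (G.ζ ((G.χ h : ZMod n) * b)) = 0 := by
    intro h hh
    rw [eval_prod]
    exact Finset.prod_eq_zero (Finset.mem_erase.2 ⟨hh, Finset.mem_univ _⟩) (by simp)
  have hne : p.eval (G.ζ b) ≠ 0 := by
    rw [eval_prod, Finset.prod_ne_zero_iff]
    intro h hh
    rw [eval_sub, eval_X, eval_C, sub_ne_zero]
    intro e
    exact Finset.ne_of_mem_erase hh (G.free.eq_one_or (G.ζ_injective e).symm hb)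
  have htr : aeval G.φ p (G.tr y) = p.eval (G.ζ b) • y := by
    rw [tr_apply, map_sum, ← Finset.add_sum_erase _ _ (Finset.mem_univ (1 : H)),
      Finset.sum_eq_zero, add_zero, map_one, Module.End.one_apply, haeval b y hyb]
    intro h hh
    rw [haeval _ _ (G.ρ_mem h b y hyb), heval h (Finset.ne_of_mem_erase hh), zero_smul]
  have hdeg : p.natDegree < Fintype.card H := by
    rw [natDegree_prod_of_monic _ _ fun h _ => monic_X_sub_C _]
    simp only [natDegree_X_sub_C, Finset.sum_const, smul_eq_mul, mul_one]
    exact Finset.card_erase_lt_of_mem (Finset.mem_univ _)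
  have hy' : y = (p.eval (G.ζ b))⁻¹ • aeval G.φ p (G.tr y) := by
    rw [htr, inv_smul_smul₀ hne]
  rw [hy']
  refine Submodule.smul_mem _ _ ?_
  rw [aeval_eq_sum_range' hdeg, LinearMap.sum_apply]
  refine Submodule.sum_mem _ fun i hi => ?_
  rw [LinearMap.smul_apply]
  refine Submodule.smul_mem _ _ (Submodule.mem_iSup_of_mem ⟨i, Finset.mem_range.1 hi⟩ ?_)
  exact Submodule.mem_map_of_mem (Submodule.mem_map_of_mem hy)

theorem φ_pow_mul (i : ℕ) (x y : L) : (G.φ ^ i) (x * y) = (G.φ ^ i) x * (G.φ ^ i) y := by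
  induction i with
  | zero => simp
  | succ i ih => rw [pow_succ', Module.End.mul_apply, Module.End.mul_apply, Module.End.mul_apply,
      ih, G.φ_mul]

theorem le_map_φ_pow {W : Submodule K L} {a : ZMod n} (hW : W ≤ G.P a) (i : ℕ) :
    W ≤ W.map (G.φ ^ i) := by
  intro x hx
  have h : ∀ i : ℕ, (G.φ ^ i) x = G.ζ a ^ i • x := by
    intro i
    induction i with
    | zero => simp
    | succ i ih =>
      rw [pow_succ', Module.End.mul_apply, ih, map_smul, G.φ_apply a x (hW hx), smul_smul, pow_succ]
  refine ⟨(G.ζ a ^ i)⁻¹ • x, W.smul_mem _ hx, ?_⟩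
  rw [map_smul, h, inv_smul_smul₀ (pow_ne_zero _ (G.ζ_ne_zero a))]

/-- For translates by one and the same power of `φ`, that power can be pulled out of the whole word,
since `φ` acts on `W` by a nonzero scalar. -/
theorem FixedNilpotent.wordSpan_map_tr_eq_bot {G : FrobeniusGrading K L H n} {c : ℕ}
    (hG : G.FixedNilpotent c) {a b : ZMod n} (ha : a ∉ resonances G.χ (List.replicate c b))
    {W Q : Submodule K L} (hW : W ≤ G.P a) (hQ : Q ≤ G.P b) {ι : Type*} (f : ι → ℕ) (i : ι) :
    wordSpan (fun j => (Q.map G.tr).map (G.φ ^ f j)) W (List.replicate c i) ≤ ⊥ := by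
  have h0 : wordSpan (fun _ : ι => Q.map G.tr) W (List.replicate c i) ≤ ⊥ := by
    refine wordSpan_le_of_forall _ _ fun x hx ys hys => ?_
    have hys' : ∀ (c : ℕ) (ys : List L), List.Forall₂ (fun y (_ : ι) => y ∈ Q.map G.tr) ys
        (List.replicate c i) → ∃ zs : List L, ys = zs.map G.tr ∧
          List.Forall₂ (fun y j => y ∈ G.P j) zs (List.replicate c b) := by
      intro c
      induction c with
      | zero =>
        intro ys hys
        cases hys
        exact ⟨[], rfl, List.Forall₂.nil⟩
      | succ c ih =>
        intro ys hys
        cases hys with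
        | cons hy hys =>
          obtain ⟨z, hz, rfl⟩ := hy
          obtain ⟨zs, rfl, hzs⟩ := ih _ hys
          exact ⟨z :: zs, rfl, List.Forall₂.cons (hQ hz) hzs⟩
    obtain ⟨zs, rfl, hzs⟩ := hys' c ys hys
    rw [Submodule.mem_bot]
    exact hG.leftNormed_eq_zero_of_notMem_resonances (by simp) ha (hW hx) hzs
  have h1 := Submodule.map_mono (f := G.φ ^ f i) h0
  rw [map_wordSpan (G.φ_pow_mul (f i)), Submodule.map_bot] at h1
  refine le_trans ?_ h1
  refine (wordSpan_mono _ (G.le_map_φ_pow hW (f i)) _).trans (le_of_eq ?_)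
  exact wordSpan_congr _ fun j hj => by rw [List.eq_of_mem_replicate hj]

end FrobeniusGrading

end Traces

/-! ### From solvability to nilpotency -/

section Nilpotency

variable {K L H : Type*} [Field K] [NonUnitalNonAssocRing L] [Module K L]
  [IsScalarTower K L L] [SMulCommClass K L L] [Group H] [Fintype H] {n : ℕ} [NeZero n]

local infixl:70 " ⋄ " => prodSpan

theorem mem_orbitSums_replicate {χ : H →* (ZMod n)ˣ} {b : ZMod n} {c : ℕ} {t : ZMod n}
    (ht : t ∈ orbitSums χ (List.replicate c b)) : ∃ x, t = x * b := by
  induction c generalizing t with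
  | zero => exact ⟨0, by simpa [orbitSums] using ht⟩
  | succ c ih =>
    rw [List.replicate_succ, orbitSums, Finset.mem_image₂] at ht
    obtain ⟨h, -, s, hs, rfl⟩ := ht
    obtain ⟨x, rfl⟩ := ih hs
    exact ⟨(χ h : ZMod n) + x, by ring⟩

/-- This handles `b` of small order: a resonant `a` is a multiple of `b`, so adding `b` soon reaches
the trivial degree zero. -/
theorem mem_resonances_replicate {χ : H →* (ZMod n)ˣ} {b : ZMod n} {c : ℕ} {a : ZMod n}
    (ha : a ∈ resonances χ (List.replicate c b)) : ∃ x, a = x * b := by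
  obtain ⟨⟨h, t, s⟩, hp, rfl⟩ := Finset.mem_image.1 ha
  simp only [Finset.mem_product] at hp
  obtain ⟨x, rfl⟩ := mem_orbitSums_replicate hp.2.1
  obtain ⟨y, rfl⟩ := mem_orbitSums_replicate hp.2.2
  exact ⟨(1 - (χ h : ZMod n))⁻¹ * (x - y), by ring⟩

/-- The arithmetic progression `a, a + b, a + 2b, …` soon reaches zero or leaves the set of
resonances. -/
theorem exists_add_nsmul_eq_zero_or_notMem (χ : H →* (ZMod n)ˣ) (a b : ZMod n) (c : ℕ) :
    ∃ k ≤ Fintype.card H ^ (2 * c + 1), a + k • b = 0 ∨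
      a + k • b ∉ resonances χ (List.replicate c b) := by
  by_cases hord : Fintype.card H ^ (2 * c + 1) < addOrderOf b
  · obtain ⟨k, hk, h⟩ := exists_add_nsmul_notMem hord a (resonances χ (List.replicate c b))
      (by simpa using card_resonances_le χ (List.replicate c b))
    exact ⟨k, hk, Or.inr h⟩
  · by_cases ha : a ∈ resonances χ (List.replicate c b)
    · obtain ⟨x, rfl⟩ := mem_resonances_replicate ha
      refine ⟨(-x).val % addOrderOf b, ?_, Or.inl ?_⟩
      · have := Nat.mod_lt (-x).val (addOrderOf_pos b)
        omega
      · rw [mod_addOrderOf_nsmul, nsmul_eq_mul, ZMod.natCast_zmod_val]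
        ring
    · exact ⟨0, Nat.zero_le _, Or.inr (by simpa using ha)⟩

namespace FrobeniusGrading

variable {G : FrobeniusGrading K L H n}

/-- After at most `q ^ (2 * c + 1)` letters the degree is zero or nonresonant. In the latter case
each of the next `q * c` letters splits into `q` translates of traces, some translate occurs `c`
times, and these copies can be moved to the front modulo `M'`. -/
theorem wordSpan_replicate_eq (hL : IsLieTypeAlgebra K L) {c : ℕ} (hG : G.FixedNilpotent c)
    {N M M' : Submodule K L} (hNφ : ∀ x ∈ N, G.φ x ∈ N) (hNρ : ∀ h, ∀ x ∈ N, G.ρ h x ∈ N)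
    (hM : M ⋄ N ≤ M) (hM' : M' ⋄ N ≤ M') (hMN : M ⋄ (N ⋄ N) ≤ M') {W : Submodule K L} {a : ZMod n}
    (hWM : W ≤ M) (hW : W ≤ G.P a) (b : ZMod n) :
    wordSpan (fun b => N ⊓ G.P b) W
      (List.replicate (Fintype.card H ^ (2 * c + 1) + Fintype.card H * c) b) ≤ M' := by
  classical
  set Q : ZMod n → Submodule K L := fun b => N ⊓ G.P b with hQ
  have hQN : ∀ b, Q b ≤ N := fun b => inf_le_left
  have hQP : Q ≤ G.P := fun b => inf_le_right
  have hMQ : ∀ b, M ⋄ Q b ≤ M := fun b => (prodSpan_mono le_rfl (hQN b)).trans hM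
  have hMQ' : ∀ b, M' ⋄ Q b ≤ M' := fun b => (prodSpan_mono le_rfl (hQN b)).trans hM'
  have hq : 0 < Fintype.card H := Fintype.card_pos
  obtain ⟨k, hk, hkb⟩ := exists_add_nsmul_eq_zero_or_notMem G.χ a b c
  have hsplit : List.replicate (Fintype.card H ^ (2 * c + 1) + Fintype.card H * c) b =
      List.replicate k b ++ (List.replicate (Fintype.card H * c) b ++
        List.replicate (Fintype.card H ^ (2 * c + 1) - k) b) := by
    simp only [List.replicate_append_replicate]
    congr 1
    omega
  rw [hsplit, wordSpan_append, wordSpan_append]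
  refine wordSpan_le_of_stable hMQ' ?_ _
  set V := wordSpan Q W (List.replicate k b) with hV
  have hVM : V ≤ M := wordSpan_le_of_stable hMQ hWM _
  have hVP : V ≤ G.P (a + k • b) := by
    refine (wordSpan_mono_left hQP hW _).trans ?_
    have := wordSpan_le_component G.mul_le (le_refl (G.P a)) (List.replicate k b)
    rwa [List.sum_replicate] at this
  rcases hkb with h0 | hres
  · rw [h0, G.zero] at hVP
    exact wordSpan_le_of_stable hMQ' (hVP.trans bot_le) _
  · let T : Fin (Fintype.card H) → Submodule K L :=
      fun i => ((Q b).map G.tr).map (G.φ ^ (i : ℕ))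
    have hQT : Q b ≤ ⨆ i, T i := by
      by_cases hb : b = 0
      · rw [hb]
        exact (hQP 0).trans (G.zero.le.trans bot_le)
      · exact G.component_le_iSup_map_tr hb (hQP b)
    have hφN : ∀ i : ℕ, ∀ x ∈ N, (G.φ ^ i) x ∈ N := by
      intro i
      induction i with
      | zero => simp
      | succ i ih =>
        intro x hx
        rw [pow_succ', Module.End.mul_apply]
        exact hNφ _ (ih x hx)
    have hTN : ∀ i, T i ≤ N := by
      rintro i _ ⟨_, ⟨y, hy, rfl⟩, rfl⟩
      refine hφN _ _ ?_
      rw [tr_apply]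
      exact Submodule.sum_mem _ fun h _ => hNρ h y (hQN b hy)
    refine (wordSpan_replicate_le_iSup hQT V _).trans (iSup_le fun l => ?_)
    have : Nonempty (Fin (Fintype.card H)) := ⟨⟨0, hq⟩⟩
    obtain ⟨i, hi⟩ := exists_le_count (l := l.1) (Finset.univ) (fun _ _ => Finset.mem_univ _)
      (B := Fintype.card H) (w := c) hq (by simp) l.2.ge
    obtain ⟨l', hl'⟩ := (List.replicate_sublist_iff.2 hi).exists_perm_append
    refine wordSpan_le_of_perm_of_stable hL
      (fun i => (prodSpan_mono le_rfl (hTN i)).trans hM)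
      (fun i => (prodSpan_mono le_rfl (hTN i)).trans hM')
      (fun i j => (prodSpan_mono le_rfl (prodSpan_mono (hTN i) (hTN j))).trans hMN) hl' V hVM ?_
    rw [wordSpan_append]
    refine wordSpan_le_of_stable (fun i => (prodSpan_mono le_rfl (hTN i)).trans hM') ?_ _
    exact (hG.wordSpan_map_tr_eq_bot hres hVP (hQP b) _ i).trans bot_le

/-- The length of the products in `wordSpan_le_of_length_le`. -/
def wordBound (q c : ℕ) : ℕ := c + q ^ (2 * c + 1) * (q ^ (2 * c + 1) + q * c)

/-- Nonresonant letters are moved greedily to the front. Either `c` of them make an independent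
word, which vanishes, or all the remaining letters lie in a bounded set of resonances and one is
repeated often enough for the previous lemma. -/
theorem wordSpan_le_of_length_le (hL : IsLieTypeAlgebra K L) {c : ℕ} (hG : G.FixedNilpotent c)
    {N M M' : Submodule K L} (hNφ : ∀ x ∈ N, G.φ x ∈ N) (hNρ : ∀ h, ∀ x ∈ N, G.ρ h x ∈ N)
    (hM : M ⋄ N ≤ M) (hM' : M' ⋄ N ≤ M') (hMN : M ⋄ (N ⋄ N) ≤ M') {W : Submodule K L} {a : ZMod n}
    (hWM : W ≤ M) (hW : W ≤ G.P a) {l : List (ZMod n)}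
    (hl : wordBound (Fintype.card H) c ≤ l.length) :
    wordSpan (fun b => N ⊓ G.P b) W l ≤ M' := by
  classical
  set Q : ZMod n → Submodule K L := fun b => N ⊓ G.P b with hQ
  have hQN : ∀ b, Q b ≤ N := fun b => inf_le_left
  have hQP : Q ≤ G.P := fun b => inf_le_right
  have hMQ : ∀ b, M ⋄ Q b ≤ M := fun b => (prodSpan_mono le_rfl (hQN b)).trans hM
  have hMQ' : ∀ b, M' ⋄ Q b ≤ M' := fun b => (prodSpan_mono le_rfl (hQN b)).trans hM'
  have hMQQ : ∀ b d, M ⋄ (Q b ⋄ Q d) ≤ M' := fun b d =>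
    (prodSpan_mono le_rfl (prodSpan_mono (hQN b) (hQN d))).trans hMN
  set B := Fintype.card H ^ (2 * c + 1) with hB
  set w := B + Fintype.card H * c with hw
  have hBpos : 0 < B := Nat.pow_pos Fintype.card_pos
  by_cases ha : a = 0
  · rw [ha, G.zero] at hW
    exact wordSpan_le_of_stable hMQ' (hW.trans bot_le) _
  suffices h : ∀ j : ℕ, ∀ front rest : List (ZMod n), front.length + j = c →
      IsIndep G.χ ((a :: front : List (ZMod n)) : Multiset (ZMod n)) → j + B * w ≤ rest.length →
      wordSpan Q W (front ++ rest) ≤ M' from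
    h c [] l (by simp) (isIndep_singleton G.free ha) hl
  intro j
  induction j with
  | zero =>
    intro front rest hfront hind _
    rw [wordSpan_append]
    refine wordSpan_le_of_stable hMQ' ?_ _
    exact (wordSpan_mono_left hQP hW _).trans
      ((hG.wordSpan_eq_bot (by simpa using hfront) hind).trans bot_le)
  | succ j ih =>
    intro front rest hfront hind hrest
    by_cases h : ∃ b ∈ rest, b ∉ resonances G.χ (a :: front)
    · obtain ⟨b, hb, hbres⟩ := h
      have hp : (front ++ rest).Perm ((front ++ [b]) ++ rest.erase b) := by
        rw [List.append_assoc]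
        exact (List.perm_cons_erase hb).append_left front
      refine wordSpan_le_of_perm_of_stable hL hMQ hMQ' hMQQ hp W hWM (ih _ _ ?_ ?_ ?_)
      · rw [List.length_append, List.length_singleton]
        omega
      · have := isIndep_cons G.free hind hbres
        convert this using 1
        rw [Multiset.cons_coe, Multiset.coe_eq_coe]
        exact List.perm_append_singleton b (a :: front)
      · rw [List.length_erase_of_mem hb]
        omega
    · push Not at h
      have hcard : (resonances G.χ (a :: front)).card ≤ B := by
        refine (card_resonances_le _ _).trans (Nat.pow_le_pow_right Fintype.card_pos ?_)
        rw [List.length_cons]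
        omega
      obtain ⟨d, hd⟩ := exists_le_count _ h hBpos hcard (by omega : B * w ≤ rest.length)
      have hd' : w ≤ (front ++ rest).count d := by
        rw [List.count_append]
        omega
      obtain ⟨l', hl'⟩ := (List.replicate_sublist_iff.2 hd').exists_perm_append
      refine wordSpan_le_of_perm_of_stable hL hMQ hMQ' hMQQ hl' W hWM ?_
      rw [wordSpan_append]
      exact wordSpan_le_of_stable hMQ'
        (wordSpan_replicate_eq hL hG hNφ hNρ hM hM' hMN hWM hW d) _

variable (G) in
/-- A subspace that is the sum of its homogeneous components. -/
def IsHomogeneous (M : Submodule K L) : Prop := M ≤ ⨆ a, M ⊓ G.P a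

theorem IsHomogeneous.prodSpan {M N : Submodule K L} (hM : G.IsHomogeneous M)
    (hN : G.IsHomogeneous N) : G.IsHomogeneous (M ⋄ N) := by
  unfold IsHomogeneous at *
  refine (prodSpan_mono hM hN).trans ?_
  rw [iSup_prodSpan]
  refine iSup_le fun a => ?_
  rw [prodSpan_iSup]
  refine iSup_le fun b => le_iSup_of_le (a + b) (le_inf ?_ ?_)
  · exact prodSpan_mono inf_le_left inf_le_left
  · exact (prodSpan_mono inf_le_right inf_le_right).trans (G.mul_le a b)

theorem wordSpan_le_of_isHomogeneous (hL : IsLieTypeAlgebra K L) {c : ℕ} (hG : G.FixedNilpotent c)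
    {N M M' : Submodule K L} (hN : G.IsHomogeneous N) (hMh : G.IsHomogeneous M)
    (hNφ : ∀ x ∈ N, G.φ x ∈ N) (hNρ : ∀ h, ∀ x ∈ N, G.ρ h x ∈ N)
    (hM : M ⋄ N ≤ M) (hM' : M' ⋄ N ≤ M') (hMN : M ⋄ (N ⋄ N) ≤ M') :
    wordSpan (fun _ : Unit => N) M
      (List.replicate (wordBound (Fintype.card H) c) ()) ≤ M' := by
  refine (wordSpan_replicate_le_iSup (Q := fun _ : Unit => N) (b := ()) hN M _).trans
    (iSup_le fun l => ?_)
  have hsup : ∀ (l : List (ZMod n)) (V : ZMod n → Submodule K L),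
      wordSpan (fun b => N ⊓ G.P b) (⨆ a, V a) l = ⨆ a, wordSpan (fun b => N ⊓ G.P b) (V a) l := by
    intro l
    induction l with
    | nil => exact fun _ => rfl
    | cons i l ih => intro V; simp only [wordSpan_cons, iSup_prodSpan, ih]
  refine (wordSpan_mono _ hMh _).trans ?_
  rw [hsup]
  exact iSup_le fun a => wordSpan_le_of_length_le hL hG hNφ hNρ hM hM' hMN inf_le_left inf_le_right
    l.2.ge

end FrobeniusGrading

theorem lowerCentral_add (N : Submodule K L) (j k : ℕ) :
    lowerCentral N (j + k) = wordSpan (fun _ : Unit => N) (lowerCentral N j)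
      (List.replicate k ()) := by
  induction k with
  | zero => rfl
  | succ k ih =>
    rw [List.replicate_succ', wordSpan_concat, ← ih]
    rfl

theorem lowerCentral_mono_right (N : Submodule K L) (hN : N ⋄ N ≤ N) {j k : ℕ} (h : j ≤ k) :
    lowerCentral N k ≤ lowerCentral N j := by
  obtain ⟨i, rfl⟩ := Nat.exists_eq_add_of_le h
  rw [lowerCentral_add]
  refine wordSpan_le_of_stable (fun _ => ?_) le_rfl _
  clear h
  induction j with
  | zero => exact hN
  | succ j ih => exact prodSpan_mono ih le_rfl

/-- This makes consecutive terms of the lower central series of `[N, N]` admissible as `M` and `M'`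
in the word lemmas. -/
theorem lowerCentral_prodSpan_self_le (hL : IsLieTypeAlgebra K L) {N : Submodule K L}
    (hN : N ⋄ N ≤ N) (i : ℕ) : lowerCentral (N ⋄ N) i ⋄ N ≤ lowerCentral (N ⋄ N) i := by
  induction i with
  | zero => exact prodSpan_mono hN le_rfl
  | succ i ih =>
    refine (hL.prodSpan_prodSpan_right _ _ _).trans (sup_le ?_ ?_)
    · exact prodSpan_mono le_rfl (prodSpan_mono hN le_rfl)
    · exact prodSpan_mono ih le_rfl

namespace FrobeniusGrading

variable {G : FrobeniusGrading K L H n}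

/-- If `[N, N]` is nilpotent, then so is `N`, for invariant homogeneous subalgebras `N`. -/
theorem lowerCentral_eq_bot_of_prodSpan (hL : IsLieTypeAlgebra K L) {c : ℕ}
    (hG : G.FixedNilpotent c) {N : Submodule K L} (hN : N ⋄ N ≤ N) (hNh : G.IsHomogeneous N)
    (hNφ : ∀ x ∈ N, G.φ x ∈ N) (hNρ : ∀ h, ∀ x ∈ N, G.ρ h x ∈ N) {k : ℕ}
    (hk : lowerCentral (N ⋄ N) k = ⊥) :
    lowerCentral N (1 + k * wordBound (Fintype.card H) c) = ⊥ := by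
  have hhom : ∀ i, G.IsHomogeneous (lowerCentral (N ⋄ N) i) := by
    intro i
    induction i with
    | zero => exact hNh.prodSpan hNh
    | succ i ih => exact ih.prodSpan (hNh.prodSpan hNh)
  -- The initial `1` is the passage from `N` to `[N, N]`; each further block of `wordBound` factors
  -- descends one term.
  have hle : ∀ i, lowerCentral N (1 + i * wordBound (Fintype.card H) c)
      ≤ lowerCentral (N ⋄ N) i := by
    intro i
    induction i with
    | zero => rw [zero_mul]; exact le_rfl
    | succ i ih =>
      rw [add_mul, one_mul, ← add_assoc, lowerCentral_add]
      refine (wordSpan_mono _ ih _).trans ?_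
      exact wordSpan_le_of_isHomogeneous hL hG hNh (hhom i) hNφ hNρ
        (lowerCentral_prodSpan_self_le hL hN i) (lowerCentral_prodSpan_self_le hL hN (i + 1)) le_rfl
  exact le_bot_iff.1 ((hle k).trans hk.le)

end FrobeniusGrading

/-- The derived series of `L`. -/
def derivedSubspace (K L : Type*) [Field K] [NonUnitalNonAssocRing L] [Module K L] :
    ℕ → Submodule K L
  | 0 => ⊤
  | k + 1 => derivedSubspace K L k ⋄ derivedSubspace K L k

theorem derivedSubspace_mem {ψ : Module.End K L} (hψ : ∀ x y, ψ (x * y) = ψ x * ψ y) (k : ℕ) :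
    ∀ x ∈ derivedSubspace K L k, ψ x ∈ derivedSubspace K L k := by
  induction k with
  | zero => exact fun _ _ => trivial
  | succ k ih =>
    intro x hx
    have h : (derivedSubspace K L (k + 1)).map ψ ≤ derivedSubspace K L (k + 1) := by
      rw [derivedSubspace, map_prodSpan hψ]
      have : (derivedSubspace K L k).map ψ ≤ derivedSubspace K L k :=
        Submodule.map_le_iff_le_comap.2 ih
      exact prodSpan_mono this this
    exact h (Submodule.mem_map_of_mem hx)

theorem derivedSubspace_closed (k : ℕ) :
    derivedSubspace K L k ⋄ derivedSubspace K L k ≤ derivedSubspace K L k := by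
  induction k with
  | zero => exact le_top
  | succ k ih => exact prodSpan_mono ih ih

theorem derivedSubspace_le_iSup {P : ZMod n → Submodule K L} (htop : ⨆ i, P i = ⊤) (s : ℕ) :
    derivedSubspace K L s ≤ ⨆ i, derivedFamily^[s] P i := by
  induction s with
  | zero => exact htop.ge
  | succ s ih =>
    rw [Function.iterate_succ_apply']
    refine (prodSpan_mono ih ih).trans ?_
    rw [iSup_prodSpan]
    refine iSup_le fun i => ?_
    rw [prodSpan_iSup]
    exact iSup_le fun j => (derivedFamily_le.1 le_rfl i j).trans (le_iSup _ (i + j))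

/-- The bound for the nilpotency class in terms of the derived length. -/
def classBound (w : ℕ) : ℕ → ℕ
  | 0 => 0
  | s + 1 => 1 + classBound w s * w

namespace FrobeniusGrading

variable {G : FrobeniusGrading K L H n}

theorem lowerCentral_derivedSubspace_eq_bot (hL : IsLieTypeAlgebra K L) {c : ℕ}
    (hG : G.FixedNilpotent c) {s : ℕ} (hs : derivedSubspace K L s = ⊥) (j : ℕ) (hj : j ≤ s) :
    lowerCentral (derivedSubspace K L (s - j)) (classBound (wordBound (Fintype.card H) c) j) = ⊥ := by
  have hhom : ∀ k, G.IsHomogeneous (derivedSubspace K L k) := by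
    intro k
    induction k with
    | zero =>
      unfold IsHomogeneous
      simp only [derivedSubspace, top_inf_eq]
      exact G.iSup_eq_top.ge
    | succ k ih => exact ih.prodSpan ih
  induction j with
  | zero => exact hs
  | succ j ih =>
    have h := ih (by omega)
    rw [show s - j = s - (j + 1) + 1 by omega] at h
    exact lowerCentral_eq_bot_of_prodSpan hL hG (derivedSubspace_closed _) (hhom _)
      (derivedSubspace_mem G.φ_mul _) (fun h => derivedSubspace_mem (G.ρ_mul h) _) h

end FrobeniusGrading

/-- A graded algebra with a Frobenius group of automorphisms is nilpotent of bounded class. -/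
theorem exists_lowerCentral_eq_bot (q c : ℕ) :
    ∃ N : ℕ, ∀ (K L H : Type*) [Field K] [NonUnitalNonAssocRing L] [Module K L]
      [IsScalarTower K L L] [SMulCommClass K L L] [Group H] [Fintype H] (n : ℕ) [NeZero n]
      (G : FrobeniusGrading K L H n), IsLieTypeAlgebra K L → Fintype.card H = q →
      G.FixedNilpotent c → lowerCentral (⊤ : Submodule K L) N = ⊥ := by
  rcases Nat.eq_zero_or_pos q with rfl | hq
  · refine ⟨0, fun K L H _ _ _ _ _ _ _ n _ G hL hH => ?_⟩
    exact absurd hH Fintype.card_ne_zero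
  obtain ⟨s, hs⟩ := exists_derivedFamily_iterate_le q hq c
  refine ⟨classBound (FrobeniusGrading.wordBound q c) s, fun K L H _ _ _ _ _ _ _ n _ G hL hH hG =>
    ?_⟩
  have h0 : IsIdealOf (⊥ : Submodule K L) := by
    intro x hx y
    rw [Submodule.mem_bot] at hx
    simp [hx]
  have h1 := hs K L H n G.χ G.P ⊥ hL hH G.free G.mul_le G.iSup_eq_top h0 G.zero.le
    fun a l hl hind => hG.wordSpan_eq_bot hl hind
  have h2 : derivedSubspace K L s = ⊥ :=
    le_bot_iff.1 ((derivedSubspace_le_iSup G.iSup_eq_top s).trans (iSup_le h1))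
  have := FrobeniusGrading.lowerCentral_derivedSubspace_eq_bot hL hG h2 s le_rfl
  rwa [Nat.sub_self, hH] at this

end Nilpotency

/-! ### Diagonalisation of an operator of finite order -/

section Eigenspaces

open Polynomial in
-- `X ^ m - 1` is a product of distinct linear factors, and kernels of coprime factors add up. No
-- finiteness of dimension is involved.
theorem iSup_eigenspace_eq_top_of_pow_eq_one {K V : Type*} [Field K] [AddCommGroup V] [Module K V]
    {φ : Module.End K V} {m : ℕ} (hm : 0 < m) {ω : K} (hω : IsPrimitiveRoot ω m)
    (hφ : φ ^ m = 1) : ⨆ μ ∈ nthRootsFinset m (1 : K), φ.eigenspace μ = ⊤ := by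
  classical
  have h : ∀ s : Finset K, LinearMap.ker (aeval φ (∏ μ ∈ s, (X - C μ))) ≤
      ⨆ μ ∈ s, φ.eigenspace μ := by
    intro s
    induction s using Finset.induction_on with
    | empty =>
      intro x hx
      simpa using hx
    | insert μ s hμ ih =>
      rw [Finset.prod_insert hμ, ← sup_ker_aeval_eq_ker_aeval_mul_of_coprime]
      · rw [Finset.iSup_insert]
        refine sup_le_sup (fun x hx => ?_) ih
        rw [Module.End.mem_eigenspace_iff]
        simpa [sub_eq_zero, Module.algebraMap_end_apply] using hx
      · refine IsCoprime.prod_right fun ν hν => isCoprime_X_sub_C_of_isUnit_sub ?_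
        exact (sub_ne_zero.2 fun e => hμ (by rwa [e])).isUnit
  refine top_unique (le_trans ?_ (h _))
  rw [← X_pow_sub_one_eq_prod hm hω]
  intro x _
  simp [hφ]

end Eigenspaces

/-! ### The eigenspace grading -/

section Grading

variable {K L H : Type*} [Field K] [NonUnitalNonAssocRing L] [Module K L]
  [IsScalarTower K L L] [SMulCommClass K L L] [Group H]

local infixl:70 " ⋄ " => prodSpan

/-- The common fixed points of a group of linear operators. -/
def fixedSubspace (ρ : H →* Module.End K L) : Submodule K L where
  carrier := {x | ∀ h, ρ h x = x}
  zero_mem' := fun h => map_zero (ρ h)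
  add_mem' := fun hx hy h => by rw [map_add, hx h, hy h]
  smul_mem' := fun k x hx h => by rw [map_smul, hx h]

theorem leftNormed_mem_lowerCentral {S : Submodule K L} (ys : List L) :
    ∀ (k : ℕ) (x : L), x ∈ lowerCentral S k → (∀ y ∈ ys, y ∈ S) →
      leftNormed x ys ∈ lowerCentral S (k + ys.length) := by
  induction ys with
  | nil => exact fun _ _ hx _ => hx
  | cons y ys ih =>
    intro k x hx hys
    have := ih (k + 1) (x * y)
      (mul_mem_prodSpan hx (hys y List.mem_cons_self)) fun z hz => hys z (List.mem_cons_of_mem _ hz)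
    rwa [add_assoc, add_comm 1] at this

/-- The grading by the eigenspaces of an automorphism `φ` normalized by a group of
automorphisms. -/
theorem exists_frobeniusGrading {n : ℕ} [NeZero n] {ω : K} (hω : IsPrimitiveRoot ω n)
    {φ : Module.End K L} (hφmul : ∀ x y, φ (x * y) = φ x * φ y) (hφn : φ ^ n = 1)
    (hφ0 : ∀ x, φ x = x → x = 0) {ρ : H →* Module.End K L}
    (hρ : ∀ h x y, ρ h (x * y) = ρ h x * ρ h y) {χ : H →* (ZMod n)ˣ} (hχ : IsFixedPointFree χ)
    (hφρ : ∀ h x, φ (ρ h x) = ρ h ((φ ^ (χ h : ZMod n).val) x)) :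
    ∃ G : FrobeniusGrading K L H n, G.ρ = ρ := by
  have hn : 0 < n := Nat.pos_of_ne_zero (NeZero.ne n)
  have hpow : ∀ (a : ZMod n) (k : ℕ), (k : ZMod n) = a → ω ^ k = ω ^ a.val := by
    rintro _ k rfl
    rw [ZMod.val_natCast, hω.eq_orderOf, pow_mod_orderOf]
  have hinj : Function.Injective fun a : ZMod n => ω ^ a.val := fun a b h =>
    ZMod.val_injective n (hω.pow_inj (ZMod.val_lt a) (ZMod.val_lt b) h)
  have hpowφ : ∀ (k : ℕ) (μ : K) (x : L), φ x = μ • x → (φ ^ k) x = μ ^ k • x := by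
    intro k μ x hx
    induction k with
    | zero => simp
    | succ k ih => rw [pow_succ', Module.End.mul_apply, ih, map_smul, hx, smul_smul, pow_succ]
  refine ⟨{ χ := χ, free := hχ, P := fun a => φ.eigenspace (ω ^ a.val), φ := φ, φ_mul := hφmul
            ζ := fun a => ω ^ a.val, ζ_injective := hinj, ρ := ρ, ρ_mul := hρ
            indep := φ.eigenspaces_iSupIndep.comp hinj
            iSup_eq_top := ?_, mul_le := ?_, zero := ?_, ζ_ne_zero := ?_, φ_apply := ?_
            ρ_mem := ?_ }, rfl⟩
  · refine top_unique ?_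
    rw [← iSup_eigenspace_eq_top_of_pow_eq_one hn hω hφn]
    refine iSup₂_le fun μ hμ => ?_
    rw [Polynomial.mem_nthRootsFinset hn] at hμ
    obtain ⟨k, -, rfl⟩ := hω.eq_pow_of_pow_eq_one hμ
    rw [hpow (k : ZMod n) k rfl]
    exact le_iSup (fun a : ZMod n => φ.eigenspace (ω ^ a.val)) (k : ZMod n)
  · intro a b
    rw [prodSpan_le]
    intro x hx y hy
    rw [Module.End.mem_eigenspace_iff] at hx hy ⊢
    rw [hφmul, hx, hy, smul_mul_smul_comm, ← pow_add, hpow (a + b)]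
    push_cast
    rw [ZMod.natCast_zmod_val, ZMod.natCast_zmod_val]
  · refine (Submodule.eq_bot_iff _).2 fun x hx => hφ0 x ?_
    rw [Module.End.mem_eigenspace_iff] at hx
    simpa using hx
  · exact fun a => pow_ne_zero _ (hω.ne_zero hn.ne')
  · exact fun a x hx => Module.End.mem_eigenspace_iff.1 hx
  · intro h a x hx
    rw [Module.End.mem_eigenspace_iff] at hx ⊢
    rw [hφρ, hpowφ _ _ _ hx, map_smul, ← pow_mul, hpow ((χ h : ZMod n) * a)]
    push_cast
    rw [ZMod.natCast_zmod_val, ZMod.natCast_zmod_val, mul_comm]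

/-- The nilpotency theorem for algebras over fields containing a primitive root of unity. -/
theorem exists_lowerCentral_eq_bot_of_isPrimitiveRoot (q c : ℕ) :
    ∃ N : ℕ, ∀ (K L H : Type*) [Field K] [NonUnitalNonAssocRing L] [Module K L]
      [IsScalarTower K L L] [SMulCommClass K L L] [Group H] [Finite H] (n : ℕ) [NeZero n]
      (ω : K) (φ : Module.End K L) (ρ : H →* Module.End K L) (χ : H →* (ZMod n)ˣ),
      IsLieTypeAlgebra K L → Nat.card H = q → IsPrimitiveRoot ω n →
      (∀ x y, φ (x * y) = φ x * φ y) → φ ^ n = 1 → (∀ x, φ x = x → x = 0) →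
      (∀ h x y, ρ h (x * y) = ρ h x * ρ h y) → IsFixedPointFree χ →
      (∀ h x, φ (ρ h x) = ρ h ((φ ^ (χ h : ZMod n).val) x)) →
      lowerCentral (fixedSubspace ρ) c = ⊥ → lowerCentral (⊤ : Submodule K L) N = ⊥ := by
  obtain ⟨N, hN⟩ := exists_lowerCentral_eq_bot q c
  refine ⟨N, fun K L H _ _ _ _ _ _ _ n _ ω φ ρ χ hL hH hω hφmul hφn hφ0 hρ hχ hφρ hc => ?_⟩
  have : Fintype H := Fintype.ofFinite H
  obtain ⟨G, rfl⟩ := exists_frobeniusGrading hω hφmul hφn hφ0 hρ hχ hφρ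
  refine hN K L H n G hL (by rw [← hH, Nat.card_eq_fintype_card]) fun x hx ys hys hlen => ?_
  have := leftNormed_mem_lowerCentral (S := fixedSubspace G.ρ) ys 0 x hx hys
  rwa [hlen, zero_add, hc, Submodule.mem_bot] at this

end Grading

/-! ### Extension of scalars -/

section BaseChange

open TensorProduct

variable {K L : Type*} [Field K] [NonUnitalNonAssocRing L] [Module K L]
  [IsScalarTower K L L] [SMulCommClass K L L] (E : Type*) [Field E] [Algebra K E]

local infixl:70 " ⋄ " => prodSpan

theorem baseChange_mul {ψ : Module.End K L} (hψ : ∀ x y, ψ (x * y) = ψ x * ψ y)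
    (x y : E ⊗[K] L) : ψ.baseChange E (x * y) = ψ.baseChange E x * ψ.baseChange E y := by
  induction x with
  | zero => simp
  | add x x' hx hx' => simp only [add_mul, map_add, hx, hx']
  | tmul a x =>
    induction y with
    | zero => simp
    | add y y' hy hy' => simp only [mul_add, map_add, hy, hy']
    | tmul b y => simp [hψ]

/-- With constant coefficients the identity is trilinear, so it may be checked on pure tensors. -/
theorem HasConstantLieTypeIdentity.isLieTypeAlgebra_baseChange
    (hL : HasConstantLieTypeIdentity K L) : IsLieTypeAlgebra E (E ⊗[K] L) := by
  obtain ⟨α, β, hα, h⟩ := hL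
  intro x y z
  refine ⟨algebraMap K E α, algebraMap K E β, by simpa using hα, ?_⟩
  simp only [algebraMap_smul]
  induction x with
  | zero => simp
  | add x x' hx hx' => simp only [add_mul, smul_add, hx, hx']; abel
  | tmul a x =>
    induction y with
    | zero => simp
    | add y y' hy hy' => simp only [add_mul, mul_add, smul_add, hy, hy']; abel
    | tmul b y =>
      induction z with
      | zero => simp
      | add z z' hz hz' => simp only [mul_add, add_mul, smul_add, hz, hz']; abel
      | tmul d z =>
        simp only [Algebra.TensorProduct.tmul_mul_tmul]
        rw [h x y z, tmul_add, tmul_smul, tmul_smul]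
        congr 3
        · ring
        · ring

theorem prodSpan_baseChange_le (V W : Submodule K L) :
    V.baseChange E ⋄ W.baseChange E ≤ (V ⋄ W).baseChange E := by
  rw [← le_leftTransporter, Submodule.baseChange_eq_span, Submodule.span_le]
  rintro _ ⟨x, hx, rfl⟩
  have h : W.baseChange E ≤ rightTransporter (Submodule.span E {(1 : E) ⊗ₜ[K] x})
      ((V ⋄ W).baseChange E) := by
    rw [Submodule.baseChange_eq_span, Submodule.span_le]
    rintro _ ⟨y, hy, rfl⟩ z hz
    obtain ⟨a, rfl⟩ := Submodule.mem_span_singleton.1 hz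
    simp only [mk_apply, smul_mul_assoc, Algebra.TensorProduct.tmul_mul_tmul, mul_one]
    exact Submodule.smul_mem _ _ (Submodule.tmul_mem_baseChange_of_mem _ (mul_mem_prodSpan hx hy))
  exact fun y hy => h hy _ (Submodule.mem_span_singleton_self _)

theorem lowerCentral_baseChange_le (S : Submodule K L) (k : ℕ) :
    lowerCentral (S.baseChange E) k ≤ (lowerCentral S k).baseChange E := by
  induction k with
  | zero => exact le_rfl
  | succ k ih => exact (prodSpan_mono ih le_rfl).trans (prodSpan_baseChange_le E _ _)

theorem lowerCentral_mono {S T : Submodule K L} (h : S ≤ T) (k : ℕ) :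
    lowerCentral S k ≤ lowerCentral T k := by
  induction k with
  | zero => exact h
  | succ k ih => exact prodSpan_mono ih h

theorem one_tmul_mem_lowerCentral (k : ℕ) (x : L) (hx : x ∈ lowerCentral (⊤ : Submodule K L) k) :
    (1 : E) ⊗ₜ[K] x ∈ lowerCentral (⊤ : Submodule E (E ⊗[K] L)) k := by
  induction k generalizing x with
  | zero => trivial
  | succ k ih =>
    have h : lowerCentral (⊤ : Submodule K L) k ⋄ ⊤ ≤
        ((lowerCentral (⊤ : Submodule E (E ⊗[K] L)) (k + 1)).restrictScalars K).comap
          (TensorProduct.mk K E L 1) := by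
      rw [prodSpan_le]
      intro x hx y _
      have := mul_mem_prodSpan (ih x hx) (Submodule.mem_top (R := E) (x := (1 : E) ⊗ₜ[K] y))
      rw [Algebra.TensorProduct.tmul_mul_tmul, mul_one] at this
      exact this
    exact h hx

theorem lowerCentral_top_eq_bot_of_baseChange {k : ℕ}
    (h : lowerCentral (⊤ : Submodule E (E ⊗[K] L)) k = ⊥) :
    lowerCentral (⊤ : Submodule K L) k = ⊥ := by
  refine (Submodule.eq_bot_iff _).2 fun x hx => ?_
  have := one_tmul_mem_lowerCentral E k x hx
  rw [h, Submodule.mem_bot] at this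
  exact Module.FaithfullyFlat.tensorProduct_mk_injective (A := K) (B := E) L (by simpa using this)

/-- Coordinates with respect to a `K`-basis of `E` are unique, so each coordinate of a fixed tensor
is fixed. -/
theorem fixedSubspace_baseChange_le {H : Type*} [Group H] (ρ : H →* Module.End K L) :
    fixedSubspace (((Module.End.baseChangeHom K E L : _ →* _)).comp ρ) ≤
      (fixedSubspace ρ).baseChange E := by
  intro x hx
  let ℬ := Module.Basis.ofVectorSpace K E
  obtain ⟨c, rfl⟩ := TensorProduct.eq_repr_basis_left ℬ x
  refine Submodule.sum_mem _ fun i _ => Submodule.tmul_mem_baseChange_of_mem _ fun h => ?_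
  have h1 : (c.sum fun i n => ℬ i ⊗ₜ[K] (ρ h n - n)) = 0 := by
    have h2 := hx h
    change (ρ h).baseChange E _ = _ at h2
    rw [← sub_eq_zero] at h2
    rw [← h2, Finsupp.sum, Finsupp.sum, map_sum, ← Finset.sum_sub_distrib]
    simp [tmul_sub]
  have h3 : c.mapRange (fun n => ρ h n - n) (by simp) = 0 := by
    refine TensorProduct.sum_tmul_basis_left_eq_zero ℬ _ ?_
    rw [Finsupp.sum_mapRange_index (by simp)]
    exact h1
  have h4 := DFunLike.congr_fun h3 i
  simpa [sub_eq_zero] using h4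

/-- The nilpotency theorem for algebras with constant coefficients of the Lie type identity. -/
theorem exists_lowerCentral_eq_bot_of_hasConstantLieTypeIdentity (q c : ℕ) :
    ∃ N : ℕ, ∀ (K L H : Type*) [Field K] [NonUnitalNonAssocRing L] [Module K L]
      [IsScalarTower K L L] [SMulCommClass K L L] [Group H] [Finite H] (n : ℕ) [NeZero n]
      (φ : Module.End K L) (ρ : H →* Module.End K L) (χ : H →* (ZMod n)ˣ),
      HasConstantLieTypeIdentity K L → Nat.card H = q →
      (∀ x y, φ (x * y) = φ x * φ y) → φ ^ n = 1 → (∀ x, φ x = x → x = 0) →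
      (∀ h x y, ρ h (x * y) = ρ h x * ρ h y) → IsFixedPointFree χ →
      (∀ h x, φ (ρ h x) = ρ h ((φ ^ (χ h : ZMod n).val) x)) →
      lowerCentral (fixedSubspace ρ) c = ⊥ → lowerCentral (⊤ : Submodule K L) N = ⊥ := by
  obtain ⟨N, hN⟩ := exists_lowerCentral_eq_bot_of_isPrimitiveRoot q c
  refine ⟨N, fun K L H _ _ _ _ _ _ _ n _ φ ρ χ hL hH hφmul hφn hφ0 hρ hχ hφρ hc => ?_⟩
  obtain ⟨p, hp⟩ := ExpChar.exists K
  -- Only the part of `n` prime to the characteristic admits a primitive root of unity, so `φ` is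
  -- replaced by `ψ = φ ^ p ^ k`.
  obtain ⟨k, m, hm, hn⟩ : ∃ k m : ℕ, (m : K) ≠ 0 ∧ n = p ^ k * m := by
    rcases hp with _ | ⟨hprime⟩
    · exact ⟨0, n, Nat.cast_ne_zero.2 (NeZero.ne n), by simp⟩
    · obtain ⟨k, m, hpm, hn⟩ := Nat.exists_eq_pow_mul_and_not_dvd (NeZero.ne n) p hprime.ne_one
      exact ⟨k, m, fun h => hpm ((CharP.cast_eq_zero_iff K p m).1 h), hn⟩
  have hm0 : NeZero m := ⟨by rintro rfl; simp at hm⟩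
  let E := AlgebraicClosure K
  have : NeZero (m : E) := ⟨by
    have := (map_ne_zero (algebraMap K E)).2 hm
    rwa [map_natCast] at this⟩
  obtain ⟨ω, hω⟩ := HasEnoughRootsOfUnity.exists_primitiveRoot E m
  have hpowmul : ∀ (j : ℕ) (x y : L), (φ ^ j) (x * y) = (φ ^ j) x * (φ ^ j) y := by
    intro j x y
    induction j with
    | zero => simp
    | succ j ih => simp only [pow_succ', Module.End.mul_apply, ih, hφmul]
  have hpowρ : ∀ (j : ℕ) (h : H) (x : L),
      (φ ^ j) (ρ h x) = ρ h ((φ ^ (j * (χ h : ZMod n).val)) x) := by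
    intro j h
    induction j with
    | zero => simp
    | succ j ih =>
      intro x
      rw [pow_succ', Module.End.mul_apply, ih, hφρ, add_mul, one_mul, add_comm, pow_add,
        Module.End.mul_apply]
  obtain ⟨ψ, hψ⟩ : ∃ ψ, ψ = φ ^ p ^ k := ⟨_, rfl⟩
  have hψm : ψ ^ m = 1 := by rw [hψ, ← pow_mul, ← hn, hφn]
  -- `ψ` still has no nonzero fixed points, as `ψ - 1 = (φ - 1) ^ p ^ k`. Stated as injectivity,
  -- this passes to the flat extension.
  have hψ0 : Function.Injective (ψ - 1 : Module.End K L) := by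
    rcases subsingleton_or_nontrivial L with hL | hL
    · exact Function.injective_of_subsingleton _
    have h1 : ψ - 1 = (φ - 1) ^ p ^ k := by
      have : ExpChar (Module.End K L) p :=
        expChar_of_injective_algebraMap (algebraMap K (Module.End K L)).injective p
      rw [hψ, sub_pow_expChar_pow_of_commute _ _ (Commute.one_right φ), one_pow]
    rw [h1, Module.End.coe_pow]
    refine Function.Injective.iterate ((injective_iff_map_eq_zero _).2 fun x hx => hφ0 x ?_) _
    simpa [sub_eq_zero] using hx
  refine lowerCentral_top_eq_bot_of_baseChange E (hN E (E ⊗[K] L) H m ω (ψ.baseChange E)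
    ((Module.End.baseChangeHom K E L : _ →* _).comp ρ)
    ((ZMod.unitsMap (Dvd.intro_left (p ^ k) hn.symm)).comp χ)
    (hL.isLieTypeAlgebra_baseChange E) hH hω (baseChange_mul E (hψ ▸ hpowmul _)) ?_ ?_
    (fun h => baseChange_mul E (hρ h)) ?_ ?_ ?_)
  · have := congrArg (Module.End.baseChangeHom K E L) hψm
    rwa [map_pow, map_one] at this
  · have h1 := Module.Flat.lTensor_preserves_injective_linearMap (M := E) _ hψ0
    intro x hx
    refine h1 ?_
    rw [map_zero, LinearMap.lTensor_sub]
    change ψ.lTensor E x - (LinearMap.id : L →ₗ[K] L).lTensor E x = 0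
    rw [LinearMap.lTensor_id, LinearMap.id_apply, sub_eq_zero]
    exact hx
  · intro h hh
    have := (hχ h hh).map (ZMod.castHom (Dvd.intro_left (p ^ k) hn.symm) (ZMod m))
    rw [map_sub, map_one] at this
    exact this
  · intro h x
    have h1 : ψ * ρ h = ρ h * ψ ^ (ZMod.cast (χ h : ZMod n) : ZMod m).val := by
      have h2 : ψ ^ (ZMod.cast (χ h : ZMod n) : ZMod m).val = ψ ^ (χ h : ZMod n).val := by
        rw [← ZMod.natCast_val, ZMod.val_natCast, ← pow_eq_pow_mod _ hψm]
      rw [h2, hψ, ← pow_mul]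
      exact LinearMap.ext fun x => hpowρ _ h x
    have h3 := congrArg (Module.End.baseChangeHom K E L) h1
    rw [map_mul, map_mul, map_pow] at h3
    exact LinearMap.congr_fun h3 x
  · refine le_bot_iff.1 ((lowerCentral_mono (fixedSubspace_baseChange_le E ρ) c).trans
      ((lowerCentral_baseChange_le E _ c).trans ?_))
    rw [hc, Submodule.baseChange_bot]

end BaseChange

/-! ### The character of the complement on a cyclic kernel -/

section FrobeniusGroup

theorem IsCyclic.exists_mulAut_apply_eq_pow (F : Type*) [Group F] [Finite F] [IsCyclic F] :
    ∃ g : F, orderOf g = Nat.card F ∧ ∀ σ : MulAut F,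
      σ g = g ^ (IsCyclic.mulAutMulEquiv F σ : ZMod (Nat.card F)).val := by
  have hn : NeZero (Nat.card F) := ⟨Nat.card_pos.ne'⟩
  let e := zmodCyclicMulEquiv (G := F) inferInstance
  refine ⟨e (Multiplicative.ofAdd 1), ?_, fun σ => ?_⟩
  · rw [MulEquiv.orderOf_eq, orderOf_ofAdd_eq_addOrderOf, ZMod.addOrderOf_one]
  · rw [← map_pow, ← ofAdd_nsmul, nsmul_one, ZMod.natCast_zmod_val]
    exact (e.apply_symm_apply _).symm

variable {G : Type*} [Group G] {F H : Subgroup G}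

theorem IsFrobeniusGroup.le_normalizer (hFH : IsFrobeniusGroup F H) :
    H ≤ Subgroup.normalizer (F : Set G) := by
  refine fun h hh => Subgroup.mem_normalizer_iff.2 fun f =>
    ⟨hFH.complement_normalizes h hh f, fun hf => ?_⟩
  have := hFH.complement_normalizes h⁻¹ (H.inv_mem hh) _ hf
  simpa [mul_assoc] using this

/-- The complement of a Frobenius group with a cyclic kernel acts on the kernel by a
fixed-point-free character. -/
theorem IsFrobeniusGroup.exists_isFixedPointFree (hFH : IsFrobeniusGroup F H) [IsCyclic F] :
    ∃ (g : F) (χ : H →* (ZMod (Nat.card F))ˣ), orderOf g = Nat.card F ∧ IsFixedPointFree χ ∧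
      ∀ h : H, (g : G) * h = h * (g : G) ^ (χ h : ZMod (Nat.card F)).val := by
  have := hFH.finite_kernel
  have hn : NeZero (Nat.card F) := ⟨Nat.card_pos.ne'⟩
  obtain ⟨g, hg, hσ⟩ := IsCyclic.exists_mulAut_apply_eq_pow F
  let κ : H →* MulAut F :=
    F.normalizerMonoidHom.comp (Subgroup.inclusion hFH.le_normalizer)
  -- The inverse gives `h⁻¹ * g * h = g ^ χ h`, the convention under which `h` maps degree `i` to
  -- degree `χ h * i`.
  let χ : H →* (ZMod (Nat.card F))ˣ := ((IsCyclic.mulAutMulEquiv F).toMonoidHom.comp κ)⁻¹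
  have hχ : ∀ h : H, (g : G) * h = h * (g : G) ^ (χ h : ZMod (Nat.card F)).val := by
    intro h
    have h1 := congrArg (Subtype.val : F → G) (hσ (κ h⁻¹))
    have h2 : ((κ h⁻¹ g : F) : G) = (h : G)⁻¹ * g * h := by
      simp [κ]
    have h3 : χ h = IsCyclic.mulAutMulEquiv F (κ h⁻¹) := by
      simp [χ]
    rw [h2, Subgroup.coe_pow, ← h3] at h1
    rw [← h1]
    group
  refine ⟨g, χ, hg, fun h hh => ?_, hχ⟩
  -- In a finite ring it suffices that `χ h - 1` is not a zero divisor; a nonzero `a` killed by it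
  -- would make `g ^ a` commute with `h`.
  rw [isUnit_iff_mem_nonZeroDivisors_of_finite, mem_nonZeroDivisors_iff_right]
  intro a ha
  by_contra ha0
  have hpow : ∀ j : ℕ, (g : G) ^ j * h = h * (g : G) ^ (j * (χ h : ZMod (Nat.card F)).val) := by
    intro j
    induction j with
    | zero => simp
    | succ j ih => rw [pow_succ', mul_assoc, ih, ← mul_assoc, hχ, mul_assoc, ← pow_add, add_mul,
        one_mul, add_comm]
  refine hFH.fixed_point_free (g ^ a.val : F) (g ^ a.val : F).2 h h.2 ?_ (by simpa using hh) ?_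
  · intro h1
    have h1 : g ^ a.val = 1 := Subtype.ext h1
    have h2 := orderOf_dvd_of_pow_eq_one h1
    rw [hg] at h2
    exact ha0 ((ZMod.val_eq_zero a).1 (Nat.eq_zero_of_dvd_of_lt h2 (ZMod.val_lt a)))
  · rw [Subgroup.coe_pow, hpow]
    congr 1
    rw [← Subgroup.coe_pow, ← Subgroup.coe_pow]
    congr 1
    rw [pow_inj_mod, hg, ← ZMod.natCast_eq_natCast_iff']
    push_cast
    rw [ZMod.natCast_zmod_val, ZMod.natCast_zmod_val]
    linear_combination -ha

end FrobeniusGroup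

/-- There is a function `f` of two variables such that the following holds for every field `K` and
every Lie type `K`-algebra `L`, of possibly infinite dimension. -/
theorem theorem1 :
    ∃ f : ℕ → ℕ → ℕ,
      ∀ (K L : Type*) [Field K] [NonUnitalNonAssocRing L] [Module K L]
        [IsScalarTower K L L] [SMulCommClass K L L]
        (F H : Subgroup (algebraAut K L)) (n q c : ℕ),
        IsLieTypeAlgebra K L →
        IsFrobeniusGroup F H →
        IsCyclic F →
        Nat.card F = n →
        Nat.card H = q →
        fixedPointSubalgebra F = ⊥ →
        IsNilpotentOfClassLE (fixedPointSubalgebra H) c →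
        ((∃ ω : K, IsPrimitiveRoot ω n) ∨ HasConstantLieTypeIdentity K L) →
        IsNilpotentOfClassLE (⊤ : NonUnitalSubalgebra K L) (f q c) := by
  choose N₁ hN₁ using exists_lowerCentral_eq_bot_of_isPrimitiveRoot
  choose N₂ hN₂ using exists_lowerCentral_eq_bot_of_hasConstantLieTypeIdentity
  -- One bound for each alternative on `K`; the lower central series decreases, so the maximum
  -- serves both.
  refine ⟨fun q c => max (N₁ q c) (N₂ q c), ?_⟩
  rintro K L _ _ _ _ _ F H _ q c hL hFH hF rfl hq hF0 hHc hK
  have := hFH.finite_kernel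
  have := hFH.finite_complement
  have hn : NeZero (Nat.card F) := ⟨Nat.card_pos.ne'⟩
  obtain ⟨g, χ, hg, hχ, hgχ⟩ := hFH.exists_isFixedPointFree
  let τ : algebraAut K L →* Module.End K L :=
    LinearEquiv.automorphismGroup.toLinearMapMonoidHom.comp (algebraAut K L).subtype
  have hmul : ∀ s : algebraAut K L, ∀ x y, τ s (x * y) = τ s x * τ s y := fun s => s.2
  have hgn : τ g ^ Nat.card F = 1 := by
    rw [← map_pow, ← Subgroup.coe_pow, ← hg, pow_orderOf_eq_one, Subgroup.coe_one, map_one]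
  have hg0 : ∀ x, τ g x = x → x = 0 := by
    intro x hx
    have h1 : x ∈ fixedPointSubalgebra F := by
      intro s hs
      obtain ⟨k, hk⟩ := mem_powers_iff_mem_zpowers.2
        ((Subgroup.eq_top_of_card_eq (Subgroup.zpowers g) (by rw [Nat.card_zpowers, hg])).ge
          (Subgroup.mem_top (⟨s, hs⟩ : F)))
      obtain rfl : ((g ^ k : F) : algebraAut K L) = s := congrArg Subtype.val hk
      change τ ((g ^ k : F) : algebraAut K L) x = x
      rw [Subgroup.coe_pow, map_pow]
      clear hk hs
      induction k with
      | zero => simp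
      | succ k ih => rw [pow_succ, Module.End.mul_apply, hx, ih]
    rw [hF0] at h1
    exact NonUnitalAlgebra.mem_bot.1 h1
  have hgH : ∀ (h : H) x, τ g (τ h x) = τ h ((τ g ^ (χ h : ZMod (Nat.card F)).val) x) := by
    intro h x
    rw [← map_pow, ← Module.End.mul_apply, ← Module.End.mul_apply, ← map_mul, ← map_mul, hgχ]
  have hle : fixedSubspace (τ.comp H.subtype) ≤ (fixedPointSubalgebra H).toSubmodule :=
    fun x hx s hs => hx ⟨s, hs⟩
  have hfix : lowerCentral (fixedSubspace (τ.comp H.subtype)) c = ⊥ :=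
    le_bot_iff.1 ((lowerCentral_mono hle c).trans hHc.le)
  have hmono : ∀ {j k : ℕ}, j ≤ k → lowerCentral (⊤ : Submodule K L) k ≤ lowerCentral ⊤ j :=
    fun h => lowerCentral_mono_right ⊤ le_top h
  change lowerCentral (⊤ : Submodule K L) _ = ⊥
  rcases hK with ⟨ω, hω⟩ | hK
  · exact le_bot_iff.1 ((hmono (le_max_left _ _)).trans (hN₁ q c K L H _ ω (τ g)
      (τ.comp H.subtype) χ hL hq hω (hmul _) hgn hg0 (fun h => hmul h) hχ hgH hfix).le)
  · exact le_bot_iff.1 ((hmono (le_max_right _ _)).trans (hN₂ q c K L H _ (τ g)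
      (τ.comp H.subtype) χ hK hq (hmul _) hgn hg0 (fun h => hmul h) hχ hgH hfix).le)
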